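/- All graphs are finite and simple. A graph $G$ is $k$-vertex-critical if $\chi(G)=k$ and $\chi(G-v)<k$ for every $v\in V(G)$. A graph is $(H_1,H_2)$-free if it has no induced subgraph isomorphic to $H_1$ or to $H_2$. Let $P_n$ be the path on $n$ vertices, let the gem be the graph consisting of a path $P_4$ and one further vertex adjacent to all four vertices of the path, and let $\overline{P_3+P_2}$ be the complement of the disjoint union of $P_3$ and $P_2$. **Theorem.** Up to isomorphism, there are exactly $7$ $5$-vertex-critical $(P_5,\text{gem})$-free graphs, and there are exactly $20$ $5$-vertex-critical $(P_5,\overline{P_3+P_2})$-free graphs. Explicitly, the graphs in each of the following two lists are pairwise non-isomorphic, and a graph belongs to the respective class if and only if it is isomorphic to a graph in the list. (A graph on $\{0,\dots,n-1\}$ is given by its adjacency lists: "$v$: $u_1\ u_2\ \dots$" means that the neighbours of $v$ are $u_1,u_2,\dots$.) The $7$ $5$-vertex-critical $(P_5,\text{gem})$-free graphs: 1. $\{$0: 1 2 3 4; 1: 0 2 3 4; 2: 0 1 3 4; 3: 0 1 2 4; 4: 0 1 2 3$\}$ 2. $\{$0: 1 4 5 6; 1: 0 2 5 6 7 8; 2: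 1 3 7 8; 3: 2 4 7 8; 4: 0 3 5 6; 5: 0 1 4 6; 6: 0 1 4 5; 7: 1 2 3 8; 8: 1 2 3 7$\}$ 3. $\{$0: 1 4 5 6; 1: 0 2 5 6; 2: 1 3 6 7 8; 3: 2 4 7 8; 4: 0 3 5 7 8; 5: 0 1 4 6; 6: 0 1 2 5; 7: 2 3 4 8; 8: 2 3 4 7$\}$ 4. $\{$0: 1 4 5 6 7; 1: 0 2 5 6 8; 2: 1 3 6 8; 3: 2 4 7 8; 4: 0 3 5 7; 5: 0 1 4 6 7; 6: 0 1 2 5 8; 7: 0 3 4 5; 8: 1 2 3 6$\}$ 5. $\{$0: 1 4 5 6; 1: 0 2 5 6 7 8 12; 2: 1 3 7 12; 3: 2 4 6 7 8 12; 4: 0 3 5 8; 5: 0 1 4 6; 6: 0 1 3 5 9 10 11; 7: 1 2 3 12; 8: 1 3 4 9 10 11; 9: 6 8 10 11; 10: 6 8 9 11; 11: 6 8 9 10; 12: 1 2 3 7$\}$ 6. $\{$0: 1 4 5 6 7 8; 1: 0 2 5 6; 2: 1 3 6 7 8 12; 3: 2 4 8 12; 4: 0 3 5 7 12; 5: 0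 1 4 6 7 8; 6: 0 1 2 5; 7: 0 2 4 5 9 10 11; 8: 0 2 3 5 9 10 11 12; 9: 7 8 10 11; 10: 7 8 9 11; 11: 7 8 9 10; 12: 2 3 4 8$\}$ 7. $\{$0: 1 4 5 6 7 8; 1: 0 2 5 6 12; 2: 1 3 6 7 8 12; 3: 2 4 8 12; 4: 0 3 5 7; 5: 0 1 4 6 7 8; 6: 0 1 2 5 12; 7: 0 2 4 5 9 10 11 12; 8: 0 2 3 5 9 10 11 12; 9: 7 8 10 11; 10: 7 8 9 11; 11: 7 8 9 10; 12: 1 2 3 6 7 8$\}$ The $20$ $5$-vertex-critical $(P_5,\overline{P_3+P_2})$-free graphs: 1. $\{$0: 1 2 3 4; 1: 0 2 3 4; 2: 0 1 3 4; 3: 0 1 2 4; 4: 0 1 2 3$\}$ 2. $\{$0: 1 4 5 6; 1: 0 2 5 6; 2: 1 3 5 6; 3: 2 4 5 6; 4: 0 3 5 6; 5: 0 1 2 3 4 6; 6: 0 1 2 3 4 5$\}$ 3. $\{$0: 1 4 5 6 7; 1: 0 2 5 6 7; 2: 1 3 5 7; 3: 2 4 6 7; 4: 0 3 5 7; 5: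 0 1 2 4 7; 6: 0 1 3 7; 7: 0 1 2 3 4 5 6$\}$ 4. $\{$0: 1 4 5 6 7; 1: 0 2 5 6 7; 2: 1 3 6 7; 3: 2 4 6 7; 4: 0 3 5 6; 5: 0 1 4 6; 6: 0 1 2 3 4 5 7; 7: 0 1 2 3 6$\}$ 5. $\{$0: 1 4 5 6 7; 1: 0 2 5 6 7; 2: 1 3 5 6 7; 3: 2 4 6 7; 4: 0 3 5 7; 5: 0 1 2 4 7; 6: 0 1 2 3 7; 7: 0 1 2 3 4 5 6$\}$ 6. $\{$0: 1 4 5 6; 1: 0 2 5 6 7; 2: 1 3 6 7; 3: 2 4 6 7; 4: 0 3 5 6; 5: 0 1 4 6; 6: 0 1 2 3 4 5 7; 7: 1 2 3 6$\}$ 7. $\{$0: 1 4 5 6; 1: 0 2 5 6 7 8; 2: 1 3 7 8; 3: 2 4 7 8; 4: 0 3 5 6; 5: 0 1 4 6; 6: 0 1 4 5; 7: 1 2 3 8; 8: 1 2 3 7$\}$ 8. $\{$0: 1 4 5 6 7 8; 1: 0 2 5 6 7 8; 2: 1 3 6 7; 3: 2 4 7 8; 4: 0 3 5 6 8; 5: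 0 1 4 6 8; 6: 0 1 2 4 5; 7: 0 1 2 3 8; 8: 0 1 3 4 5 7$\}$ 9. $\{$0: 1 4 5 6 7 8; 1: 0 2 5 6 7; 2: 1 3 5 6 8; 3: 2 4 6 7 8; 4: 0 3 5 7 8; 5: 0 1 2 4 8; 6: 0 1 2 3 7 8; 7: 0 1 3 4 6; 8: 0 2 3 4 5 6$\}$ 10. $\{$0: 1 4 5 6; 1: 0 2 5 6; 2: 1 3 6 7 8; 3: 2 4 7 8; 4: 0 3 5 7 8; 5: 0 1 4 6; 6: 0 1 2 5; 7: 2 3 4 8; 8: 2 3 4 7$\}$ 11. $\{$0: 1 4 5 6 7; 1: 0 2 5 6 8; 2: 1 3 6 8; 3: 2 4 7 8; 4: 0 3 5 7; 5: 0 1 4 6 7; 6: 0 1 2 5 8; 7: 0 3 4 5; 8: 1 2 3 6$\}$ 12. $\{$0: 1 4 5 6 7; 1: 0 2 5 6 7; 2: 1 3 6 7 8; 3: 2 4 7 8; 4: 0 3 5 7 8; 5: 0 1 4 6 8; 6: 0 1 2 5 8; 7: 0 1 2 3 4; 8: 2 3 4 5 6$\}$ 13. $\{$0: 1 4 5 6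 7; 1: 0 2 5 6 7; 2: 1 3 6 7 8; 3: 2 4 7 8; 4: 0 3 5 7 8; 5: 0 1 4 6; 6: 0 1 2 5; 7: 0 1 2 3 4 8; 8: 2 3 4 7$\}$ 14. $\{$0: 1 4 5 6 7 8; 1: 0 2 5 6 7; 2: 1 3 6 7; 3: 2 4 7 8; 4: 0 3 5 7 8; 5: 0 1 4 6 8; 6: 0 1 2 5 8; 7: 0 1 2 3 4; 8: 0 3 4 5 6$\}$ 15. $\{$0: 1 4 5 6 7 8; 1: 0 2 5 6 7; 2: 1 3 6 7 8; 3: 2 4 7 8; 4: 0 3 5 7 8; 5: 0 1 4 6; 6: 0 1 2 5 8; 7: 0 1 2 3 4 8; 8: 0 2 3 4 6 7$\}$ 16. $\{$0: 1 4 5 6 7 8; 1: 0 2 5 6 7 8; 2: 1 3 6 7 8; 3: 2 4 7 8; 4: 0 3 5 7; 5: 0 1 4 6; 6: 0 1 2 5 8; 7: 0 1 2 3 4 8; 8: 0 1 2 3 6 7$\}$ 17. $\{$0: 1 4 5 6 7; 1: 0 2 5 6 7 8; 2: 1 3 6 7 8; 3: 2 4 7 8; 4: 0 3 5 6; 5: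 0 1 4 6; 6: 0 1 2 4 5; 7: 0 1 2 3 8; 8: 1 2 3 7$\}$ 18. $\{$0: 1 4 5 6 7; 1: 0 2 5 6 7 8; 2: 1 3 6 7 8; 3: 2 4 7 8; 4: 0 3 5 6; 5: 0 1 4 6 8; 6: 0 1 2 4 5; 7: 0 1 2 3 8; 8: 1 2 3 5 7$\}$ 19. $\{$0: 1 4 5 6 8; 1: 0 2 5 6 7 8; 2: 1 3 6 7; 3: 2 4 6 7; 4: 0 3 5 6 8; 5: 0 1 4 6 8; 6: 0 1 2 3 4 5; 7: 1 2 3 8; 8: 0 1 4 5 7$\}$ 20. $\{$0: 1 4 5 6; 1: 0 2 5 6 7 8; 2: 1 3 6 7 8; 3: 2 4 7 8; 4: 0 3 5 6; 5: 0 1 4 6; 6: 0 1 2 4 5; 7: 1 2 3 8; 8: 1 2 3 7$\}$ -/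

import Mathlib

open scoped SimpleGraph

/-- A graph `G` is `k`-vertex-critical if `χ(G) = k` and `χ(G - v) < k` for every vertex `v`. -/
def IsVertexCritical {V : Type*} (k : ℕ) (G : SimpleGraph V) : Prop :=
  G.chromaticNumber = k ∧ ∀ v : V, (G.induce {v}ᶜ).chromaticNumber < k

/-- `G` is `(H₁, H₂)`-free: neither `H₁` nor `H₂` is isomorphic to an induced subgraph of `G`. -/
def IsPairFree {V W₁ W₂ : Type*} (H₁ : SimpleGraph W₁) (H₂ : SimpleGraph W₂)
    (G : SimpleGraph V) : Prop :=
  ¬ H₁.IsIndContained G ∧ ¬ H₂.IsIndContained G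

/-- The gem: the path `0 - 1 - 2 - 3` together with the vertex `4`, adjacent to all of it. -/
def gem : SimpleGraph (Fin 5) :=
  SimpleGraph.fromRel fun i j => (i : ℕ) + 1 = j ∨ j = 4

/-- The complement of the disjoint union `P₃ + P₂`. -/
def coP3P2 : SimpleGraph (Fin 3 ⊕ Fin 2) :=
  (SimpleGraph.pathGraph 3 ⊕g SimpleGraph.pathGraph 2)ᶜ

/-- Two finite graphs are equivalent if they are isomorphic. -/
def isoSetoid : Setoid (Σ n : ℕ, SimpleGraph (Fin n)) where
  r G H := Nonempty (G.2 ≃g H.2)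
  iseqv := ⟨fun _ => ⟨SimpleGraph.Iso.refl⟩, fun ⟨e⟩ => ⟨e.symm⟩, fun ⟨e⟩ ⟨f⟩ => ⟨e.trans f⟩⟩

/-- The isomorphism classes of finite graphs. -/
def IsoClass : Type := Quotient isoSetoid

/-- The isomorphism class of a graph on `{0, …, n - 1}`. -/
def isoClass {n : ℕ} (G : SimpleGraph (Fin n)) : IsoClass := Quotient.mk isoSetoid ⟨n, G⟩

/-- The set of isomorphism classes of the finite `k`-vertex-critical `(H₁, H₂)`-free graphs. -/
def criticalClasses {W₁ W₂ : Type*} (k : ℕ) (H₁ : SimpleGraph W₁) (H₂ : SimpleGraph W₂) :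
    Set IsoClass :=
  {c | ∃ (n : ℕ) (G : SimpleGraph (Fin n)),
    isoClass G = c ∧ IsVertexCritical k G ∧ IsPairFree H₁ H₂ G}

/-- The graph on `{0, …, n - 1}` with the adjacency lists `L = [N(0), …, N(n - 1)]`. -/
def adjListGraph (L : List (List ℕ)) : SimpleGraph (Fin L.length) :=
  SimpleGraph.fromRel fun i j => (j : ℕ) ∈ L[i]

/-- Adjacency lists of seven graphs; the `i`-th entry of a graph is the neighbourhood of `i`. -/
def gemList : List (List (List ℕ)) :=
  [[[1, 2, 3, 4], [0, 2, 3, 4], [0, 1, 3, 4], [0, 1, 2, 4], [0, 1, 2, 3]],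
   [[1, 4, 5, 6], [0, 2, 5, 6, 7, 8], [1, 3, 7, 8], [2, 4, 7, 8], [0, 3, 5, 6], [0, 1, 4, 6],
    [0, 1, 4, 5], [1, 2, 3, 8], [1, 2, 3, 7]],
   [[1, 4, 5, 6], [0, 2, 5, 6], [1, 3, 6, 7, 8], [2, 4, 7, 8], [0, 3, 5, 7, 8], [0, 1, 4, 6],
    [0, 1, 2, 5], [2, 3, 4, 8], [2, 3, 4, 7]],
   [[1, 4, 5, 6, 7], [0, 2, 5, 6, 8], [1, 3, 6, 8], [2, 4, 7, 8], [0, 3, 5, 7],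
    [0, 1, 4, 6, 7], [0, 1, 2, 5, 8], [0, 3, 4, 5], [1, 2, 3, 6]],
   [[1, 4, 5, 6], [0, 2, 5, 6, 7, 8, 12], [1, 3, 7, 12], [2, 4, 6, 7, 8, 12], [0, 3, 5, 8],
    [0, 1, 4, 6], [0, 1, 3, 5, 9, 10, 11], [1, 2, 3, 12], [1, 3, 4, 9, 10, 11],
    [6, 8, 10, 11], [6, 8, 9, 11], [6, 8, 9, 10], [1, 2, 3, 7]],
   [[1, 4, 5, 6, 7, 8], [0, 2, 5, 6], [1, 3, 6, 7, 8, 12], [2, 4, 8, 12], [0, 3, 5, 7, 12],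
    [0, 1, 4, 6, 7, 8], [0, 1, 2, 5], [0, 2, 4, 5, 9, 10, 11], [0, 2, 3, 5, 9, 10, 11, 12],
    [7, 8, 10, 11], [7, 8, 9, 11], [7, 8, 9, 10], [2, 3, 4, 8]],
   [[1, 4, 5, 6, 7, 8], [0, 2, 5, 6, 12], [1, 3, 6, 7, 8, 12], [2, 4, 8, 12], [0, 3, 5, 7],
    [0, 1, 4, 6, 7, 8], [0, 1, 2, 5, 12], [0, 2, 4, 5, 9, 10, 11, 12],
    [0, 2, 3, 5, 9, 10, 11, 12], [7, 8, 10, 11], [7, 8, 9, 11], [7, 8, 9, 10],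
    [1, 2, 3, 6, 7, 8]]]

/-- Adjacency lists of twenty graphs; the `i`-th entry of a graph is the neighbourhood of `i`. -/
def coP3P2List : List (List (List ℕ)) :=
  [[[1, 2, 3, 4], [0, 2, 3, 4], [0, 1, 3, 4], [0, 1, 2, 4], [0, 1, 2, 3]],
   [[1, 4, 5, 6], [0, 2, 5, 6], [1, 3, 5, 6], [2, 4, 5, 6], [0, 3, 5, 6], [0, 1, 2, 3, 4, 6],
    [0, 1, 2, 3, 4, 5]],
   [[1, 4, 5, 6, 7], [0, 2, 5, 6, 7], [1, 3, 5, 7], [2, 4, 6, 7], [0, 3, 5, 7],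
    [0, 1, 2, 4, 7], [0, 1, 3, 7], [0, 1, 2, 3, 4, 5, 6]],
   [[1, 4, 5, 6, 7], [0, 2, 5, 6, 7], [1, 3, 6, 7], [2, 4, 6, 7], [0, 3, 5, 6], [0, 1, 4, 6],
    [0, 1, 2, 3, 4, 5, 7], [0, 1, 2, 3, 6]],
   [[1, 4, 5, 6, 7], [0, 2, 5, 6, 7], [1, 3, 5, 6, 7], [2, 4, 6, 7], [0, 3, 5, 7],
    [0, 1, 2, 4, 7], [0, 1, 2, 3, 7], [0, 1, 2, 3, 4, 5, 6]],
   [[1, 4, 5, 6], [0, 2, 5, 6, 7], [1, 3, 6, 7], [2, 4, 6, 7], [0, 3, 5, 6], [0, 1, 4, 6],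
    [0, 1, 2, 3, 4, 5, 7], [1, 2, 3, 6]],
   [[1, 4, 5, 6], [0, 2, 5, 6, 7, 8], [1, 3, 7, 8], [2, 4, 7, 8], [0, 3, 5, 6], [0, 1, 4, 6],
    [0, 1, 4, 5], [1, 2, 3, 8], [1, 2, 3, 7]],
   [[1, 4, 5, 6, 7, 8], [0, 2, 5, 6, 7, 8], [1, 3, 6, 7], [2, 4, 7, 8], [0, 3, 5, 6, 8],
    [0, 1, 4, 6, 8], [0, 1, 2, 4, 5], [0, 1, 2, 3, 8], [0, 1, 3, 4, 5, 7]],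
   [[1, 4, 5, 6, 7, 8], [0, 2, 5, 6, 7], [1, 3, 5, 6, 8], [2, 4, 6, 7, 8], [0, 3, 5, 7, 8],
    [0, 1, 2, 4, 8], [0, 1, 2, 3, 7, 8], [0, 1, 3, 4, 6], [0, 2, 3, 4, 5, 6]],
   [[1, 4, 5, 6], [0, 2, 5, 6], [1, 3, 6, 7, 8], [2, 4, 7, 8], [0, 3, 5, 7, 8], [0, 1, 4, 6],
    [0, 1, 2, 5], [2, 3, 4, 8], [2, 3, 4, 7]],
   [[1, 4, 5, 6, 7], [0, 2, 5, 6, 8], [1, 3, 6, 8], [2, 4, 7, 8], [0, 3, 5, 7],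
    [0, 1, 4, 6, 7], [0, 1, 2, 5, 8], [0, 3, 4, 5], [1, 2, 3, 6]],
   [[1, 4, 5, 6, 7], [0, 2, 5, 6, 7], [1, 3, 6, 7, 8], [2, 4, 7, 8], [0, 3, 5, 7, 8],
    [0, 1, 4, 6, 8], [0, 1, 2, 5, 8], [0, 1, 2, 3, 4], [2, 3, 4, 5, 6]],
   [[1, 4, 5, 6, 7], [0, 2, 5, 6, 7], [1, 3, 6, 7, 8], [2, 4, 7, 8], [0, 3, 5, 7, 8],
    [0, 1, 4, 6], [0, 1, 2, 5], [0, 1, 2, 3, 4, 8], [2, 3, 4, 7]],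
   [[1, 4, 5, 6, 7, 8], [0, 2, 5, 6, 7], [1, 3, 6, 7], [2, 4, 7, 8], [0, 3, 5, 7, 8],
    [0, 1, 4, 6, 8], [0, 1, 2, 5, 8], [0, 1, 2, 3, 4], [0, 3, 4, 5, 6]],
   [[1, 4, 5, 6, 7, 8], [0, 2, 5, 6, 7], [1, 3, 6, 7, 8], [2, 4, 7, 8], [0, 3, 5, 7, 8],
    [0, 1, 4, 6], [0, 1, 2, 5, 8], [0, 1, 2, 3, 4, 8], [0, 2, 3, 4, 6, 7]],
   [[1, 4, 5, 6, 7, 8], [0, 2, 5, 6, 7, 8], [1, 3, 6, 7, 8], [2, 4, 7, 8], [0, 3, 5, 7],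
    [0, 1, 4, 6], [0, 1, 2, 5, 8], [0, 1, 2, 3, 4, 8], [0, 1, 2, 3, 6, 7]],
   [[1, 4, 5, 6, 7], [0, 2, 5, 6, 7, 8], [1, 3, 6, 7, 8], [2, 4, 7, 8], [0, 3, 5, 6],
    [0, 1, 4, 6], [0, 1, 2, 4, 5], [0, 1, 2, 3, 8], [1, 2, 3, 7]],
   [[1, 4, 5, 6, 7], [0, 2, 5, 6, 7, 8], [1, 3, 6, 7, 8], [2, 4, 7, 8], [0, 3, 5, 6],
    [0, 1, 4, 6, 8], [0, 1, 2, 4, 5], [0, 1, 2, 3, 8], [1, 2, 3, 5, 7]],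
   [[1, 4, 5, 6, 8], [0, 2, 5, 6, 7, 8], [1, 3, 6, 7], [2, 4, 6, 7], [0, 3, 5, 6, 8],
    [0, 1, 4, 6, 8], [0, 1, 2, 3, 4, 5], [1, 2, 3, 8], [0, 1, 4, 5, 7]],
   [[1, 4, 5, 6], [0, 2, 5, 6, 7, 8], [1, 3, 6, 7, 8], [2, 4, 7, 8], [0, 3, 5, 6],
    [0, 1, 4, 6], [0, 1, 2, 4, 5], [1, 2, 3, 8], [1, 2, 3, 7]]]

/-!
A vertex outside an induced subgraph `N` of `G` has a *type*, its set of neighbours in `N`. We add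
vertices to `N` one at a time, keeping a list of the types that may still occur in `G`: a type
dies if it creates a forbidden subgraph, and a type may be dropped once all graphs in which it
occurs have been dealt with. Criticality of `G` tells us which types to branch on. If `N` has too
few colours to be all of `G`, then every vertex of small degree in `N` needs a further neighbour;
and if a clique `A` in `N` is mapped to a disjoint clique `B` in such a way that the neighbours of
each vertex of `A` outside `A` are neighbours of its image, then some vertex outside `N` is
adjacent to a vertex of `A` and not to its image, since otherwise `A` could be coloured like `B`
in a colouring of `G - A`. If `N` is not `4`-colourable, then `N` is all of `G`, and the same
arguments show that `N` is listed or contains a forbidden or listed graph.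

Starting from a single vertex, this does not end. We first exclude that `G` contains certain
graphs on five vertices, which are added to the forbidden graphs one after the other: the bull,
the chair and the kite in the class of `(P₅, gem)`-free graphs, and the house, the kite and the
gem in the class of `(P₅, co-(P₃ + P₂))`-free graphs.
-/

section Critical

variable {V W : Type*} {G : SimpleGraph V} {k : ℕ}

theorem isVertexCritical_succ_iff : IsVertexCritical (k + 1) G ↔
    ¬ G.Colorable k ∧ ∀ v, (G.induce {v}ᶜ).Colorable k := by
  have lt_iff {U : Type _} (H : SimpleGraph U) :
      H.chromaticNumber < (k + 1 : ℕ) ↔ H.Colorable k := by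
    rw [← SimpleGraph.chromaticNumber_le_iff_colorable, Nat.cast_add_one]
    exact ENat.lt_add_one_iff (ENat.natCast_ne_top k)
  refine ⟨fun ⟨h, h'⟩ => ⟨fun hc => ?_, fun v => (lt_iff _).1 (h' v)⟩,
    fun ⟨h, h'⟩ => ⟨le_antisymm ?_ (not_lt.1 fun hlt => h ((lt_iff G).1 hlt)),
      fun v => (lt_iff _).2 (h' v)⟩⟩
  · exact ((lt_iff G).2 hc).ne h
  · rw [SimpleGraph.chromaticNumber_le_iff_colorable]
    rcases isEmpty_or_nonempty V with _ | ⟨⟨v⟩⟩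
    · exact SimpleGraph.Colorable.of_isEmpty _
    classical
    obtain ⟨c⟩ := h' v
    let d : V → Option (Fin k) := fun x => if hx : x = v then none else some (c ⟨x, hx⟩)
    have hd {x y} (hxy : G.Adj x y) : d x ≠ d y := by
      by_cases hx : x = v <;> by_cases hy : y = v <;> simp only [d, hx, hy, dite_true, dite_false]
      · exact (hxy.ne (hx.trans hy.symm)).elim
      · simp
      · simp
      · exact fun e => c.valid (v := ⟨x, hx⟩) (w := ⟨y, hy⟩) hxy (Option.some_injective _ e)
    simpa using (SimpleGraph.Coloring.mk d hd).colorable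

namespace IsVertexCritical

theorem not_colorable (hG : IsVertexCritical (k + 1) G) : ¬ G.Colorable k :=
  (isVertexCritical_succ_iff.1 hG).1

theorem nonempty (hG : IsVertexCritical (k + 1) G) : Nonempty V := by
  by_contra! h
  exact hG.not_colorable (SimpleGraph.Colorable.of_isEmpty k)

theorem colorable_induce (hG : IsVertexCritical (k + 1) G) {S : Set V} (hS : S ≠ Set.univ) :
    (G.induce S).Colorable k := by
  obtain ⟨v, hv⟩ := (Set.ne_univ_iff_exists_notMem S).1 hS
  have hsub : S ⊆ {v}ᶜ := fun x hx h => hv (h ▸ hx)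
  exact ((isVertexCritical_succ_iff.1 hG).2 v).of_hom (SimpleGraph.induceHomOfLE G hsub).toHom

theorem exists_adj_eq (hG : IsVertexCritical (k + 1) G) {S : Set V}
    (c : (G.induce S).Coloring (Fin k)) (d : (G.induce Sᶜ).Coloring (Fin k)) :
    ∃ (x : S) (y : (Sᶜ : Set V)), G.Adj x y ∧ c x = d y := by
  classical
  by_contra! hne
  refine hG.not_colorable ⟨SimpleGraph.Coloring.mk
    (fun x => if hx : x ∈ S then c ⟨x, hx⟩ else d ⟨x, hx⟩) fun {x y} hxy => ?_⟩
  by_cases hx : x ∈ S <;> by_cases hy : y ∈ S <;> simp only [hx, hy, dite_true, dite_false]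
  · exact c.valid (SimpleGraph.comap_adj.2 hxy)
  · exact hne ⟨x, hx⟩ ⟨y, hy⟩ hxy
  · exact (hne ⟨y, hy⟩ ⟨x, hx⟩ hxy.symm).symm
  · exact d.valid (SimpleGraph.comap_adj.2 hxy)

theorem exists_adj_of_colorable (hG : IsVertexCritical (k + 1) G) {S : Set V} (hS : S.Nonempty)
    (hc : (G.induce S).Colorable k) : ∃ x ∈ S, ∃ y ∉ S, G.Adj x y := by
  obtain ⟨c⟩ := hc
  obtain ⟨d⟩ := hG.colorable_induce (S := Sᶜ) (by simp [hS.ne_empty])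
  obtain ⟨x, y, hxy, -⟩ := hG.exists_adj_eq c d
  exact ⟨x, x.2, y, y.2, hxy⟩

theorem exists_adj_notMem (hG : IsVertexCritical (k + 1) G) (v : V) {s : Finset V}
    (hs : s.card < k) : ∃ w ∉ s, G.Adj v w := by
  classical
  by_contra! hv
  obtain ⟨d⟩ := hG.colorable_induce (S := {v}ᶜ) (by simp)
  let used : Finset (Fin k) := s.image fun x => if hx : x ∈ ({v}ᶜ : Set V) then d ⟨x, hx⟩
    else ⟨0, by omega⟩
  obtain ⟨m, hm⟩ : ∃ m, m ∉ used := by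
    by_contra! hall
    have := Finset.card_le_card fun m (_ : m ∈ Finset.univ) => hall m
    simpa using this.trans_lt (Finset.card_image_le.trans_lt hs)
  let c : (G.induce {v}).Coloring (Fin k) := SimpleGraph.Coloring.mk (fun _ => m)
    fun {x y} hxy => (hxy.ne (Subsingleton.elim x y)).elim
  obtain ⟨⟨x, rfl⟩, y, hxy, hmy⟩ := hG.exists_adj_eq c d
  have hys : (y : V) ∈ s := by
    by_contra hy
    exact hv y hy hxy
  refine hm (Finset.mem_image.2 ⟨y, hys, ?_⟩)
  rw [dif_pos y.2]
  exact hmy.symm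

/-- Recolouring each `a i` with the colour of `b i` must fail. -/
theorem exists_adj_not_adj (hG : IsVertexCritical (k + 1) G) {ι : Type*} [Nonempty ι]
    {a b : ι → V} (ha : a.Injective) (hb : ∀ i, b i ∉ Set.range a)
    (hab : ∀ i j, G.Adj (a i) (a j) → G.Adj (b i) (b j)) :
    ∃ i, ∃ w ∉ Set.range a, G.Adj (a i) w ∧ ¬ G.Adj (b i) w := by
  obtain ⟨d⟩ := hG.colorable_induce (S := (Set.range a)ᶜ)
    (by simp)
  let e := Equiv.ofInjective a ha
  let c : (G.induce (Set.range a)).Coloring (Fin k) :=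
    SimpleGraph.Coloring.mk (fun x => d ⟨b (e.symm x), hb _⟩) fun {x y} hxy => d.valid <|
      hab _ _ <| by simpa [e, Equiv.apply_ofInjective_symm ha] using hxy
  obtain ⟨x, w, hxw, hcw⟩ := hG.exists_adj_eq c d
  refine ⟨e.symm x, w, w.2, by simpa [e, Equiv.apply_ofInjective_symm ha] using hxw,
    fun hbw => d.valid (v := ⟨b (e.symm x), hb _⟩) (w := w) hbw hcw⟩

theorem surjective_of_embedding {H : SimpleGraph W} (hG : IsVertexCritical (k + 1) G)
    (hH : ¬ H.Colorable k) (φ : H ↪g G) : Function.Surjective φ := by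
  rw [← Set.range_eq_univ]
  by_contra hne
  exact hH ((hG.colorable_induce hne).of_hom
    ⟨fun x => ⟨φ x, x, rfl⟩, fun {_ _} hxy => φ.map_adj_iff.2 hxy⟩)

end IsVertexCritical

end Critical

section Counting

variable {W₁ W₂ : Type*} {k : ℕ} {H₁ : SimpleGraph W₁} {H₂ : SimpleGraph W₂}
  {Ls : List (List (List ℕ))}

theorem isoClass_eq_iff {m n : ℕ} {G : SimpleGraph (Fin m)} {H : SimpleGraph (Fin n)} :
    isoClass G = isoClass H ↔ Nonempty (G ≃g H) :=
  Quotient.eq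

theorem encard_criticalClasses
    (hiff : ∀ (V : Type) (G : SimpleGraph V),
      IsVertexCritical k G ∧ IsPairFree H₁ H₂ G ↔ ∃ L ∈ Ls, Nonempty (G ≃g adjListGraph L))
    (hne : Ls.Pairwise fun L M => IsEmpty (adjListGraph L ≃g adjListGraph M)) :
    (criticalClasses k H₁ H₂).encard = Ls.length := by
  classical
  have hnodup : (Ls.map fun L => isoClass (adjListGraph L)).Nodup :=
    List.pairwise_map.2 <| hne.imp fun {L M} hLM h => by
      obtain ⟨e⟩ := isoClass_eq_iff.1 h
      exact hLM.false e
  have heq : criticalClasses k H₁ H₂ =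
      ((Ls.map fun L => isoClass (adjListGraph L)).toFinset : Set IsoClass) := by
    ext c
    simp only [criticalClasses, Set.mem_ofPred_eq, List.coe_toFinset, List.mem_map]
    constructor
    · rintro ⟨n, G, rfl, hG⟩
      obtain ⟨L, hL, ⟨e⟩⟩ := (hiff _ G).1 hG
      exact ⟨L, hL, isoClass_eq_iff.2 ⟨e.symm⟩⟩
    · rintro ⟨L, hL, rfl⟩
      exact ⟨_, adjListGraph L, rfl, (hiff _ _).2 ⟨L, hL, ⟨SimpleGraph.Iso.refl⟩⟩⟩
  rw [heq, Set.encard_coe_eq_coe_finsetCard, List.toFinset_card_of_nodup hnodup, List.length_map]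

end Counting

/-! ### Combinators for evaluation in the kernel -/

namespace CriticalSearch

section Folds

variable {α β : Type}

/-- `List.foldr`, written with the recursor, which the kernel unfolds in a single step; the
functions below replace those of the library for the same reason. -/
def fold (f : α → β → β) (b : β) (l : List α) : β :=
  List.rec b (fun a _ => f a) l

/-- `fold` with access to the tail of the list. -/
def foldTails (f : α → List α → β → β) (b : β) (l : List α) : β :=
  List.rec b f l

/-- The conditional on a Boolean. -/
def sel (b : Bool) (x y : α) : α :=
  Bool.rec y x b

/-- Disjunction. -/
def orB (a b : Bool) : Bool :=
  Bool.rec b true a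

/-- Conjunction. -/
def andB (a b : Bool) : Bool :=
  Bool.rec false b a

/-- `List.any`. -/
def anyB (p : α → Bool) (l : List α) : Bool :=
  fold (fun a r => orB (p a) r) false l

/-- `List.all`. -/
def allB (p : α → Bool) (l : List α) : Bool :=
  fold (fun a r => andB (p a) r) true l

/-- `List.map`. -/
def mapB (f : α → β) (l : List α) : List β :=
  fold (fun a r => f a :: r) [] l

/-- `List.filter`. -/
def filterB (p : α → Bool) (l : List α) : List α :=
  fold (fun a r => sel (p a) (a :: r) r) [] l

/-- `List.append`. -/
def appB (l m : List α) : List α :=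
  fold List.cons m l

/-- `f n`, where `n` is evaluated to a numeral before it is substituted: the recursor has to
evaluate its major premise `n + 1`. -/
def forceNat (n : ℕ) (f : ℕ → α) : α :=
  Nat.rec (f 0) (fun m _ => f m) (Nat.add n 1)

/-- `k l`, where `l` and its entries are evaluated first; an entry is evaluated by `force`. -/
def forceBy (force : β → (β → α) → α) (l : List β) (k : List β → α) : α :=
  fold (fun b ih k => force b fun b' => ih fun l => k (b' :: l)) (fun k => k []) l k

/-- `k l`, where `l` and its entries are evaluated first. -/
def forceList (l : List ℕ) (k : List ℕ → α) : α :=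
  forceBy forceNat l k

theorem fold_cons (f : α → β → β) (b : β) (a : α) (l : List α) :
    fold f b (a :: l) = f a (fold f b l) := rfl

theorem foldTails_cons (f : α → List α → β → β) (b : β) (a : α) (l : List α) :
    foldTails f b (a :: l) = f a l (foldTails f b l) := rfl

@[simp] theorem sel_eq (b : Bool) (x y : α) : sel b x y = if b then x else y := by
  cases b <;> rfl

@[simp] theorem orB_eq (a b : Bool) : orB a b = (a || b) := by
  cases a <;> rfl

@[simp] theorem andB_eq (a b : Bool) : andB a b = (a && b) := by
  cases a <;> rfl

@[simp] theorem anyB_eq (p : α → Bool) (l : List α) : anyB p l = l.any p := by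
  induction l with
  | nil => rfl
  | cons a l ih => rw [anyB, fold_cons, orB_eq, List.any_cons, ← ih, anyB]

@[simp] theorem allB_eq (p : α → Bool) (l : List α) : allB p l = l.all p := by
  induction l with
  | nil => rfl
  | cons a l ih => rw [allB, fold_cons, andB_eq, List.all_cons, ← ih, allB]

@[simp] theorem mapB_eq (f : α → β) (l : List α) : mapB f l = l.map f := by
  induction l with
  | nil => rfl
  | cons a l ih => rw [mapB, fold_cons, List.map_cons, ← ih, mapB]

@[simp] theorem filterB_eq (p : α → Bool) (l : List α) : filterB p l = l.filter p := by
  induction l with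
  | nil => rfl
  | cons a l ih => rw [filterB, fold_cons, sel_eq, List.filter_cons, ← ih, filterB]

@[simp] theorem appB_eq (l m : List α) : appB l m = l ++ m := by
  induction l with
  | nil => rfl
  | cons a l ih => rw [appB, fold_cons, List.cons_append, ← ih, appB]

@[simp] theorem forceNat_eq (n : ℕ) (f : ℕ → α) : forceNat n f = f n := rfl

theorem forceBy_eq {force : β → (β → α) → α} (hf : ∀ b k, force b k = k b) (l : List β)
    (k : List β → α) : forceBy force l k = k l := by
  induction l generalizing k with
  | nil => rfl
  | cons b l ih => exact (hf b _).trans (ih _)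

@[simp] theorem forceList_eq (l : List ℕ) (k : List ℕ → α) : forceList l k = k l :=
  forceBy_eq forceNat_eq l k

end Folds

section Bits

/-- `Nat.testBit`, in operations on numerals that the kernel implements. -/
def bit (n i : ℕ) : Bool :=
  Nat.beq (Nat.land (Nat.shiftRight n i) 1) 1

/-- Difference of two sets encoded as bit masks. -/
def diff (m n : ℕ) : ℕ :=
  Nat.xor m (Nat.land m n)

/-- Whether a mask is empty. -/
def isZero (n : ℕ) : Bool :=
  Nat.beq n 0

/-- A mask without its largest element. -/
def dropTop (n : ℕ) : ℕ :=
  Nat.mod n (Nat.pow 2 (Nat.log2 n))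

/-- A mask without its `c` largest elements. -/
def dropTops (c n : ℕ) : ℕ :=
  Nat.rec (motive := fun _ => ℕ → ℕ) (fun n => n) (fun _ ih n => forceNat (dropTop n) ih) c n

theorem bit_eq (n i : ℕ) : bit n i = n.testBit i := by
  rw [Bool.eq_iff_iff, bit, Nat.beq_eq, Nat.testBit_eq_decide_div_mod_eq, decide_eq_true_iff,
    ← Nat.shiftRight_eq_div_pow, ← Nat.and_one_is_mod]
  rfl

@[simp] theorem bit_zero (i : ℕ) : bit 0 i = false := by
  simp [bit_eq]

@[simp] theorem bit_and (m n i : ℕ) : bit (m &&& n) i = (bit m i && bit n i) := by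
  simp only [bit_eq, Nat.testBit_and]

@[simp] theorem bit_or (m n i : ℕ) : bit (m ||| n) i = (bit m i || bit n i) := by
  simp only [bit_eq, Nat.testBit_or]

@[simp] theorem bit_diff (m n i : ℕ) : bit (diff m n) i = (bit m i && !bit n i) := by
  simp only [diff, Nat.xor_eq, Nat.land_eq, bit_eq, Nat.testBit_xor, Nat.testBit_and]
  cases m.testBit i <;> cases n.testBit i <;> rfl

@[simp] theorem bit_two_pow (n i : ℕ) : bit (2 ^ n) i = decide (n = i) := by
  rw [bit_eq, Nat.testBit_two_pow]

@[simp] theorem bit_shiftRight (m n i : ℕ) : bit (m >>> n) i = bit m (n + i) := by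
  simp only [bit_eq, Nat.testBit_shiftRight]

@[simp] theorem bit_two_pow_sub_one (n i : ℕ) : bit (2 ^ n - 1) i = decide (i < n) := by
  rw [bit_eq, Nat.testBit_two_pow_sub_one]

theorem isZero_iff {n : ℕ} : isZero n = true ↔ ∀ i, bit n i = false := by
  simp only [isZero, Nat.beq_eq, bit_eq]
  exact ⟨fun h i => h ▸ Nat.zero_testBit i, Nat.zero_of_testBit_eq_false⟩

theorem eq_log2_or_bit_dropTop {n i : ℕ} (h : bit n i = true) :
    i = Nat.log2 n ∨ bit (dropTop n) i = true := by
  have hn : n ≠ 0 := by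
    rintro rfl
    simp at h
  have hle : i ≤ Nat.log2 n := by
    rw [Nat.le_log2 hn]
    exact Nat.ge_two_pow_of_testBit (bit_eq n i ▸ h)
  rcases hle.eq_or_lt with h' | h'
  · exact .inl h'
  · refine .inr ?_
    rw [bit_eq] at h ⊢
    exact (Nat.testBit_mod_two_pow n _ i).trans (by simp [h, h'])

theorem exists_card_le_of_dropTops {c n : ℕ} (h : isZero (dropTops c n) = true) :
    ∃ s : Finset ℕ, s.card ≤ c ∧ ∀ i, bit n i = true → i ∈ s := by
  induction c generalizing n with
  | zero =>
    refine ⟨∅, by simp, fun i hi => ?_⟩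
    have hn : bit n i = false := isZero_iff.1 h i
    exact absurd hi (by simp [hn])
  | succ c ih =>
    obtain ⟨s, hs, hns⟩ := ih (n := dropTop n) h
    refine ⟨insert (Nat.log2 n) s, (Finset.card_insert_le _ _).trans (by omega), fun i hi => ?_⟩
    exact Finset.mem_insert.2 ((eq_log2_or_bit_dropTop hi).imp_right (hns i))

end Bits

section Copies

variable {V : Type*} {G : SimpleGraph V} {N : List ℕ} {f : ℕ → V} {n : ℕ}

/-- Whether `i` and `j` are adjacent in the graph on `0, …, n - 1` whose vertex `i` has the
neighbourhood encoded by the mask `N[i]`. -/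
def adj (N : List ℕ) (i j : ℕ) : Bool :=
  bit (N.getD i 0) j

/-- The list of masks `N` encodes a symmetric irreflexive relation on its index range. -/
def IsGraph (N : List ℕ) : Prop :=
  ∀ i j, adj N i j = true → i ≠ j ∧ adj N j i = true

/-- Check that a list of masks encodes a graph. -/
def graphCheck (N : List ℕ) : Bool :=
  N.all (· < 2 ^ N.length) && (List.range N.length).all fun i => !adj N i i &&
    (List.range i).all fun j => adj N i j == adj N j i

/-- The map `f` embeds the graph encoded by `N` into `G`; values of `f` beyond the length of `N`
play no role. -/
structure IsCopy (N : List ℕ) (G : SimpleGraph V) (f : ℕ → V) : Prop where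
  injOn : Set.InjOn f (Set.Iio N.length)
  adj_iff : ∀ {i}, i < N.length → ∀ j, adj N i j = true ↔ j < N.length ∧ G.Adj (f i) (f j)

theorem adj_of_length_le {i : ℕ} (hi : N.length ≤ i) (j : ℕ) : adj N i j = false := by
  rw [adj, List.getD_eq_default _ _ hi, bit_zero]

theorem isGraph_of_graphCheck (h : graphCheck N = true) : IsGraph N := by
  simp only [graphCheck, Bool.and_eq_true, List.all_eq_true, decide_eq_true_eq, List.mem_range,
    beq_iff_eq, Bool.not_eq_true'] at h
  obtain ⟨hlt, h⟩ := h
  have lt_length {i j : ℕ} (hij : adj N i j = true) : i < N.length ∧ j < N.length := by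
    have hi : i < N.length := by
      by_contra hi
      simp [adj_of_length_le (not_lt.1 hi)] at hij
    rw [adj, bit_eq, List.getD_eq_getElem _ _ hi] at hij
    exact ⟨hi, (Nat.pow_lt_pow_iff_right one_lt_two).1 <|
      (Nat.ge_two_pow_of_testBit hij).trans_lt (hlt _ (List.getElem_mem hi))⟩
  intro i j hij
  obtain ⟨hi, hj⟩ := lt_length hij
  rcases lt_trichotomy i j with hlt | rfl | hlt
  · exact ⟨hlt.ne, ((h j hj).2 i hlt).trans hij⟩
  · simp [(h i hi).1] at hij
  · exact ⟨hlt.ne', ((h i hi).2 j hlt).symm.trans hij⟩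

theorem IsGraph.lt_length (hN : IsGraph N) {i j : ℕ} (h : adj N i j = true) : j < N.length := by
  by_contra hj
  simpa [adj_of_length_le (not_lt.1 hj)] using (hN i j h).2

theorem IsGraph.isCopy (hN : IsGraph N)
    (h : ∀ i < N.length, ∀ j < i, f i ≠ f j ∧ (adj N i j = true ↔ G.Adj (f i) (f j))) :
    IsCopy N G f := by
  have symm (i j : ℕ) : adj N i j = true ↔ adj N j i = true :=
    ⟨fun h => (hN i j h).2, fun h => (hN j i h).2⟩
  refine ⟨fun i hi j hj hij => ?_, fun {i} hi j => ⟨fun hij => ?_, fun ⟨hj, hij⟩ => ?_⟩⟩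
  · rcases lt_trichotomy i j with hlt | rfl | hlt
    · exact ((h j hj i hlt).1 hij.symm).elim
    · rfl
    · exact ((h i hi j hlt).1 hij).elim
  · have hj := hN.lt_length hij
    rcases (hN i j hij).1.lt_or_gt with hlt | hlt
    · exact ⟨hj, ((h j hj i hlt).2.1 ((symm i j).1 hij)).symm⟩
    · exact ⟨hj, (h i hi j hlt).2.1 hij⟩
  · rcases lt_trichotomy i j with hlt | rfl | hlt
    · exact (symm i j).2 ((h j hj i hlt).2.2 hij.symm)
    · exact (hij.ne rfl).elim
    · exact (h i hi j hlt).2.2 hij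

/-- Append a vertex with neighbourhood `s`. -/
def extend (N : List ℕ) (s : ℕ) : List ℕ :=
  appB (mapB (fun p => Nat.lor p.1 (sel (bit s p.2) (Nat.pow 2 N.length) 0)) N.zipIdx) [s]

/-- The mask `s` encodes the neighbours of `w` among `f 0, …, f (n - 1)`. -/
def Realizes (G : SimpleGraph V) (f : ℕ → V) (n : ℕ) (w : V) (s : ℕ) : Prop :=
  ∀ i, bit s i = true ↔ i < n ∧ G.Adj (f i) w

theorem adj_append_of_lt {i : ℕ} (hi : i < N.length) (M : List ℕ) (j : ℕ) :
    adj (N ++ M) i j = adj N i j := by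
  rw [adj, List.getD_append _ _ _ _ hi, adj]

theorem exists_realizes (G : SimpleGraph V) (f : ℕ → V) (n : ℕ) (w : V) :
    ∃ s < 2 ^ n, Realizes G f n w s := by
  classical
  refine ⟨Nat.ofBits fun i : Fin n => decide (G.Adj (f i) w), Nat.ofBits_lt_two_pow _, fun i => ?_⟩
  by_cases hi : i < n <;> simp [bit_eq, Nat.testBit_ofBits_lt, Nat.testBit_ofBits_ge, hi, not_lt.1]

theorem IsCopy.congr (hf : IsCopy N G f) {g : ℕ → V} (hg : ∀ i < N.length, g i = f i) :
    IsCopy N G g := by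
  refine ⟨hf.injOn.congr fun i hi => (hg i hi).symm, fun {i} hi j => ?_⟩
  rw [hf.adj_iff hi, hg i hi]
  exact and_congr_right fun hj => by rw [hg j hj]

theorem IsCopy.extend (hf : IsCopy N G f) {s : ℕ} (hs : Realizes G f N.length (f N.length) s)
    (hw : ∀ i < N.length, f i ≠ f N.length) : IsCopy (extend N s) G f := by
  have hlen : (CriticalSearch.extend N s).length = N.length + 1 := by
    simp [CriticalSearch.extend]
  have adj_lt {i : ℕ} (hi : i < N.length) (j : ℕ) :
      adj (CriticalSearch.extend N s) i j = (adj N i j || (bit s i && decide (N.length = j))) := by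
    simp only [CriticalSearch.extend, appB_eq, mapB_eq]
    rw [adj_append_of_lt (by simpa using hi), adj, List.getD_eq_getElem _ _ (by simpa using hi)]
    cases h : bit s i <;> simp [adj, hi, h]
  have adj_last (j : ℕ) : adj (CriticalSearch.extend N s) N.length j = bit s j := by
    simp [CriticalSearch.extend, adj]
  refine ⟨fun i hi j hj hij => ?_, fun {i} hi j => ?_⟩
  · rw [Set.mem_Iio, hlen, Nat.lt_succ_iff_lt_or_eq] at hi hj
    rcases hi with hi | rfl <;> rcases hj with hj | rfl
    · exact hf.injOn hi hj hij
    · exact (hw i hi hij).elim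
    · exact (hw j hj hij.symm).elim
    · rfl
  · rw [hlen] at hi ⊢
    rcases Nat.lt_succ_iff_lt_or_eq.1 hi with hi | rfl
    · rw [adj_lt hi, Bool.or_eq_true, Bool.and_eq_true, hf.adj_iff hi, hs i, decide_eq_true_eq]
      constructor
      · rintro (⟨hj, h⟩ | ⟨⟨-, h⟩, rfl⟩)
        exacts [⟨hj.trans (Nat.lt_succ_self _), h⟩, ⟨Nat.lt_succ_self _, h⟩]
      · rintro ⟨hj, h⟩
        rcases Nat.lt_succ_iff_lt_or_eq.1 hj with hj | rfl
        exacts [.inl ⟨hj, h⟩, .inr ⟨⟨hi, h⟩, rfl⟩]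
    · rw [adj_last, hs j, G.adj_comm, Nat.lt_succ_iff_lt_or_eq, or_and_right]
      refine (or_iff_left ?_).symm
      rintro ⟨rfl, h⟩
      exact h.ne rfl

end Copies

/-- A vertex as it is handled by the search: its number, the mask of its neighbours, and a label
(the mask of the adjacent types, or an isomorphism invariant). -/
structure Vtx where
  /-- The number of the vertex. -/
  idx : ℕ
  /-- The mask of its neighbours. -/
  row : ℕ
  /-- The label. -/
  label : ℕ

/-- The labelled vertices of the graph encoded by `N`. -/
def vertices (label : ℕ → ℕ) (N : List ℕ) : List Vtx :=
  mapB (fun p => ⟨p.2, p.1, label p.2⟩) N.zipIdx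

/-- `k l`, where `l` and the numbers in it are evaluated first. -/
def forceVertices {α : Type} (l : List Vtx) (k : List Vtx → α) : α :=
  forceBy (fun v k => forceNat v.idx fun i => forceNat v.row fun r => forceNat v.label fun c =>
    k ⟨i, r, c⟩) l k

@[simp] theorem forceVertices_eq {α : Type} (l : List Vtx) (k : List Vtx → α) :
    forceVertices l k = k l :=
  forceBy_eq (fun _ _ => rfl) l k

theorem mem_vertices {label : ℕ → ℕ} {N : List ℕ} {v : Vtx} :
    v ∈ vertices label N ↔ ∃ i < N.length, v = ⟨i, N.getD i 0, label i⟩ := by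
  simp only [vertices, mapB_eq, List.mem_map, Prod.exists, List.mk_mem_zipIdx_iff_getElem?]
  constructor
  · rintro ⟨r, i, hi, rfl⟩
    obtain ⟨hlt, rfl⟩ := List.getElem?_eq_some_iff.1 hi
    exact ⟨i, hlt, by rw [List.getD_eq_getElem _ _ hlt]⟩
  · rintro ⟨i, hi, rfl⟩
    exact ⟨N[i], i, List.getElem?_eq_getElem hi, by rw [List.getD_eq_getElem _ _ hi]⟩

section Colouring

variable {V : Type*} {G : SimpleGraph V} {f : ℕ → V} {n k : ℕ} {vs : List Vtx}

/-- The entry `v` describes the vertex `f v.idx` of the subgraph of `G` on `f 0, …, f (n - 1)`. -/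
structure Vtx.Represents (G : SimpleGraph V) (f : ℕ → V) (n : ℕ) (v : Vtx) : Prop where
  idx_lt : v.idx < n
  bit_row : ∀ i, bit v.row i = true ↔ i < n ∧ G.Adj (f v.idx) (f i)

theorem IsCopy.represents {N : List ℕ} (hf : IsCopy N G f) {label : ℕ → ℕ} {v : Vtx}
    (hv : v ∈ vertices label N) : v.Represents G f N.length := by
  obtain ⟨i, hi, rfl⟩ := mem_vertices.1 hv
  exact ⟨hi, hf.adj_iff hi⟩

/-- Whether `k` accepts the list `l` with one entry `m` for which `test m` holds replaced by
`join m`. -/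
def joinAny (test : ℕ → Bool) (join : ℕ → ℕ) (l : List ℕ) (k : List ℕ → Bool) : Bool :=
  foldTails (fun m rest ih k => orB
      (andB (test m) (forceNat (join m) fun m' => k (m' :: rest))) (ih fun l => k (m :: l)))
    (fun _ => false) l k

/-- Whether the colour classes `cls` extend over `vs` to at most `k` independent classes. -/
def colourableFrom (k : ℕ) (vs : List Vtx) (cls : List ℕ) : Bool :=
  fold (fun v ih cls => orB
      (joinAny (fun m => isZero (Nat.land m v.row)) (fun m => Nat.lor m (Nat.pow 2 v.idx)) cls ih)
      (andB (Nat.blt cls.length k) (forceNat (Nat.pow 2 v.idx) fun m => ih (m :: cls))))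
    (fun _ => true) vs cls

/-- Whether the vertices `vs` have a proper colouring with `k` colours. -/
def colourable (k : ℕ) (vs : List Vtx) : Bool :=
  colourableFrom k vs []

theorem joinAny_eq_true {test : ℕ → Bool} {join : ℕ → ℕ} {l : List ℕ} {k : List ℕ → Bool} :
    joinAny test join l k = true ↔
      ∃ l₁ m l₂, l = l₁ ++ m :: l₂ ∧ test m = true ∧ k (l₁ ++ join m :: l₂) = true := by
  induction l generalizing k with
  | nil => simp [joinAny, foldTails]
  | cons a l ih =>
    have unfold_cons : joinAny test join (a :: l) k =
        (test a && k (join a :: l) || joinAny test join l fun l => k (a :: l)) := by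
      rw [← andB_eq, ← orB_eq]
      rfl
    rw [unfold_cons, Bool.or_eq_true, Bool.and_eq_true, ih]
    constructor
    · rintro (⟨ht, hk⟩ | ⟨l₁, m, l₂, rfl, ht, hk⟩)
      exacts [⟨[], a, l, rfl, ht, hk⟩, ⟨a :: l₁, m, l₂, rfl, ht, hk⟩]
    · rintro ⟨_ | ⟨b, l₁⟩, m, l₂, h, ht, hk⟩
      · obtain ⟨rfl, rfl⟩ := List.cons.inj h
        exact .inl ⟨ht, hk⟩
      · obtain ⟨rfl, rfl⟩ := List.cons.inj h
        exact .inr ⟨l₁, m, l₂, rfl, ht, hk⟩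

theorem colourableFrom_cons {v : Vtx} {cls : List ℕ} :
    colourableFrom k (v :: vs) cls = true ↔
      (∃ l₁ m l₂, cls = l₁ ++ m :: l₂ ∧ (∀ i, bit m i = true → bit v.row i = false) ∧
        colourableFrom k vs (l₁ ++ (m ||| 2 ^ v.idx) :: l₂) = true) ∨
      cls.length < k ∧ colourableFrom k vs (2 ^ v.idx :: cls) = true := by
  rw [colourableFrom, fold_cons, orB_eq, andB_eq, Bool.or_eq_true, Bool.and_eq_true,
    joinAny_eq_true, Nat.blt_eq]
  simp only [isZero_iff, Nat.land_eq, bit_and, Bool.and_eq_false_imp]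
  rfl

/-- The mask `m` encodes a set of pairwise nonadjacent vertices among `f 0, …, f (n - 1)`. -/
def IsIndep (G : SimpleGraph V) (f : ℕ → V) (n m : ℕ) : Prop :=
  ∀ i j, bit m i = true → bit m j = true → i < n ∧ ¬ G.Adj (f i) (f j)

theorem isIndep_two_pow {i : ℕ} (hi : i < n) : IsIndep G f n (2 ^ i) := by
  intro j k hj hk
  simp only [bit_two_pow, decide_eq_true_eq] at hj hk
  subst hj hk
  exact ⟨hi, G.irrefl⟩

theorem IsIndep.or_two_pow {m : ℕ} (hm : IsIndep G f n m) {v : Vtx} (hv : v.Represents G f n)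
    (hmv : ∀ i, bit m i = true → bit v.row i = false) : IsIndep G f n (m ||| 2 ^ v.idx) := by
  have not_adj {i : ℕ} (hi : bit m i = true) : ¬ G.Adj (f v.idx) (f i) := fun h => by
    simpa [hmv i hi] using (hv.bit_row i).2 ⟨(hm i i hi hi).1, h⟩
  intro i j hi hj
  simp only [bit_or, bit_two_pow, Bool.or_eq_true, decide_eq_true_eq] at hi hj
  rcases hi with hi | rfl <;> rcases hj with hj | rfl
  · exact hm i j hi hj
  · exact ⟨(hm i i hi hi).1, fun h => not_adj hi h.symm⟩
  · exact ⟨hv.idx_lt, not_adj hj⟩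
  · exact ⟨hv.idx_lt, G.irrefl⟩

theorem exists_classes_of_colourableFrom (hvs : ∀ v ∈ vs, v.Represents G f n) {cls : List ℕ}
    (hk : cls.length ≤ k) (hcls : ∀ m ∈ cls, IsIndep G f n m)
    (h : colourableFrom k vs cls = true) :
    ∃ D : List ℕ, D.length ≤ k ∧ (∀ m ∈ D, IsIndep G f n m) ∧
      (∀ m ∈ cls, ∃ m' ∈ D, ∀ i, bit m i = true → bit m' i = true) ∧
      ∀ v ∈ vs, ∃ m ∈ D, bit m v.idx = true := by
  induction vs generalizing cls with
  | nil => exact ⟨cls, hk, hcls, fun m hm => ⟨m, hm, fun _ => id⟩, by simp⟩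
  | cons v vs ih =>
    rw [List.forall_mem_cons] at hvs
    rcases colourableFrom_cons.1 h with ⟨l₁, m, l₂, rfl, hmv, h⟩ | ⟨hlt, h⟩
    · have hm : IsIndep G f n (m ||| 2 ^ v.idx) := (hcls m (by simp)).or_two_pow hvs.1 hmv
      obtain ⟨D, hD, hind, hsub, hcov⟩ := ih hvs.2 (by simpa using hk)
        (by simp only [List.forall_mem_append, List.forall_mem_cons] at hcls ⊢; tauto) h
      simp only [List.forall_mem_append, List.forall_mem_cons] at hsub ⊢
      obtain ⟨hl₁, ⟨m', hm', hsub⟩, hl₂⟩ := hsub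
      exact ⟨D, hD, hind, ⟨hl₁, ⟨m', hm', fun i hi => hsub i (by simp [hi])⟩, hl₂⟩,
        ⟨m', hm', hsub _ (by simp)⟩, hcov⟩
    · obtain ⟨D, hD, hind, hsub, hcov⟩ := ih hvs.2 (by simpa using hlt)
        (List.forall_mem_cons.2 ⟨isIndep_two_pow hvs.1.idx_lt, hcls⟩) h
      rw [List.forall_mem_cons] at hsub
      obtain ⟨⟨m', hm', hv⟩, hsub⟩ := hsub
      exact ⟨D, hD, hind, hsub, List.forall_mem_cons.2 ⟨⟨m', hm', hv _ (by simp)⟩, hcov⟩⟩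

theorem colourableFrom_of_coloring {c : ℕ → Option (Fin k)}
    (hc : ∀ v ∈ vs, ∃ a, c v.idx = some a ∧ ∀ i, bit v.row i = true → c i ≠ some a)
    {used : List (Fin k)} (hused : used.Nodup) {μ : Fin k → ℕ}
    (hμ : ∀ a i, bit (μ a) i = true → c i = some a) : colourableFrom k vs (used.map μ) = true := by
  induction vs generalizing used μ with
  | nil => rfl
  | cons v vs ih =>
    obtain ⟨⟨a, hva, hrow⟩, hc⟩ := List.forall_mem_cons.1 hc
    rw [colourableFrom_cons]
    have map_update {l : List (Fin k)} (ha : a ∉ l) (m : ℕ) :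
        l.map (Function.update μ a m) = l.map μ :=
      List.map_congr_left fun b hb =>
        Function.update_of_ne (fun h : b = a => ha (h ▸ hb)) m μ
    have hμ' {m : ℕ} (hm : ∀ i, bit m i = true → c i = some a) :
        ∀ b i, bit (Function.update μ a m b) i = true → c i = some b := by
      intro b i
      rcases eq_or_ne b a with rfl | hb
      · simpa using hm i
      · simpa [hb] using hμ b i
    by_cases ha : a ∈ used
    · obtain ⟨l₁, l₂, rfl⟩ := List.append_of_mem ha
      refine .inl ⟨l₁.map μ, μ a, l₂.map μ, by simp, fun i hi => ?_, ?_⟩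
      · by_contra hbit
        exact hrow i (by simpa using hbit) (hμ _ i hi)
      · have hm (i : ℕ) (hi : bit (μ a ||| 2 ^ v.idx) i = true) : c i = some a := by
          simp only [bit_or, bit_two_pow, Bool.or_eq_true, decide_eq_true_eq] at hi
          exact hi.elim (hμ _ i) fun h => h ▸ hva
        have hnd := List.nodup_middle.1 hused
        simp only [List.nodup_cons, List.mem_append, not_or] at hnd
        simpa [map_update hnd.1.1, map_update hnd.1.2] using ih hc hused (hμ' hm)
    · have hnd : (a :: used).Nodup := List.nodup_cons.2 ⟨ha, hused⟩
      have hm (i : ℕ) (hi : bit (2 ^ v.idx) i = true) : c i = some a := by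
        rw [bit_two_pow, decide_eq_true_eq] at hi
        rw [← hi, hva]
      refine .inr ⟨by simpa using hnd.length_le_card, ?_⟩
      simpa [map_update ha] using ih hc hnd (hμ' hm)

theorem colourable_iff (hvs : ∀ v ∈ vs, v.Represents G f n) :
    colourable k vs = true ↔ (G.induce {x | ∃ v ∈ vs, f v.idx = x}).Colorable k := by
  classical
  constructor
  · intro h
    obtain ⟨D, hD, hind, -, hcov⟩ := exists_classes_of_colourableFrom hvs (Nat.zero_le k)
      (by simp) h
    choose rep hrep hfrep using fun x : {x | ∃ v ∈ vs, f v.idx = x} => x.2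
    choose m hm hbit using fun x => hcov _ (hrep x)
    refine (SimpleGraph.Coloring.mk
      (fun x => (⟨D.idxOf (m x), List.idxOf_lt_length_of_mem (hm x)⟩ : Fin D.length))
      fun {x y} hxy hcol => ?_).colorable.mono (by simpa using hD)
    have hmxy : m x = m y := (List.idxOf_inj (hm x)).1 (Fin.val_eq_of_eq hcol)
    refine (hind _ (hm x) _ _ (hbit x) (hmxy ▸ hbit y)).2 ?_
    rw [hfrep, hfrep]
    exact hxy
  · rintro ⟨C⟩
    let c (i : ℕ) : Option (Fin k) :=
      if h : ∃ v ∈ vs, f v.idx = f i then some (C ⟨f i, h⟩) else none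
    refine colourableFrom_of_coloring (c := c) (used := []) (μ := fun _ => 0) (fun v hv => ?_)
      List.nodup_nil (by simp)
    have hv' : ∃ u ∈ vs, f u.idx = f v.idx := ⟨v, hv, rfl⟩
    refine ⟨C ⟨f v.idx, hv'⟩, dif_pos hv', fun i hi hci => ?_⟩
    by_cases h : ∃ u ∈ vs, f u.idx = f i
    · rw [show c i = some (C ⟨f i, h⟩) from dif_pos h, Option.some_inj] at hci
      exact C.valid (v := ⟨f v.idx, hv'⟩) (w := ⟨f i, h⟩) (((hvs v hv).bit_row i).1 hi).2 hci.symm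
    · rw [show c i = none from dif_neg h] at hci
      cases hci

end Colouring

section Walks

/-- The sum of the entries of `c` whose index belongs to the mask `r`. -/
def sumOver (r : ℕ) (c : List ℕ) : ℕ :=
  fold (fun x ih r => Nat.add (sel (bit r 0) x 0) (forceNat (Nat.shiftRight r 1) ih))
    (fun _ => 0) c r

/-- The number of walks of length `k` from each vertex. -/
def walkCounts (N : List ℕ) (k : ℕ) : List ℕ :=
  Nat.rec (mapB (fun _ => 1) N) (fun _ ih => forceList ih fun c => mapB (fun r => sumOver r c) N) k

theorem sumOver_eq_sum (r : ℕ) (c : List ℕ) :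
    sumOver r c = ∑ i : Fin c.length, if bit r i then c.getD i 0 else 0 := by
  induction c generalizing r with
  | nil => rfl
  | cons x c ih =>
    have unfold_cons : sumOver r (x :: c) = (if bit r 0 then x else 0) + sumOver (r >>> 1) c := by
      rw [← sel_eq]
      rfl
    rw [unfold_cons, ih]
    simp only [List.length_cons, Fin.sum_univ_succ, bit_shiftRight, Nat.add_comm 1]
    simp

theorem walkCounts_succ (N : List ℕ) (k : ℕ) :
    walkCounts N (k + 1) = N.map fun r => sumOver r (walkCounts N k) :=
  (forceList_eq _ _).trans (mapB_eq _ _)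

@[simp] theorem length_walkCounts (N : List ℕ) (k : ℕ) : (walkCounts N k).length = N.length := by
  cases k with
  | zero => exact (congrArg _ (mapB_eq _ N)).trans (List.length_map _)
  | succ k => rw [walkCounts_succ, List.length_map]

theorem getD_walkCounts_succ {N : List ℕ} {i : ℕ} (hi : i < N.length) (k : ℕ) :
    (walkCounts N (k + 1)).getD i 0 =
      ∑ j : Fin N.length, if adj N i j then (walkCounts N k).getD j 0 else 0 := by
  rw [walkCounts_succ, List.getD_eq_getElem _ _ (by simpa using hi), List.getElem_map,
    sumOver_eq_sum, ← (finCongr (length_walkCounts N k)).sum_comp]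
  simp [adj, hi]

variable {V : Type*} {G : SimpleGraph V} {M N : List ℕ} {f g : ℕ → V}

/-- `IsCopy` for a spanning subgraph. -/
structure IsFullCopy (N : List ℕ) (G : SimpleGraph V) (f : ℕ → V) : Prop extends
    IsCopy N G f where
  exists_eq : ∀ x, ∃ i < N.length, f i = x

theorem IsFullCopy.exists_equiv (hf : IsFullCopy N G f) :
    ∃ e : Fin N.length ≃ V, ∀ i, e i = f i :=
  ⟨Equiv.ofBijective (fun i => f i) ⟨fun i j h => Fin.ext (hf.injOn i.2 j.2 h),
    fun x => let ⟨i, hi, h⟩ := hf.exists_eq x; ⟨⟨i, hi⟩, h⟩⟩, fun _ => rfl⟩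

theorem IsFullCopy.walkCounts_eq (hf : IsFullCopy N G f) (hg : IsFullCopy M G g)
    (σ : Fin N.length ≃ Fin M.length) (hσ : ∀ i, g (σ i) = f i) (k : ℕ) (i : Fin N.length) :
    (walkCounts N k).getD i 0 = (walkCounts M k).getD (σ i) 0 := by
  induction k generalizing i with
  | zero => simp [walkCounts]
  | succ k ih =>
    rw [getD_walkCounts_succ i.2, getD_walkCounts_succ (σ i).2, ← σ.sum_comp]
    refine Finset.sum_congr rfl fun j _ => ?_
    have hadj : adj N i j = adj M (σ i) (σ j) := by
      rw [Bool.eq_iff_iff, hf.adj_iff i.2, hg.adj_iff (σ i).2, hσ, hσ]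
      simp
    rw [hadj, ih]

theorem IsFullCopy.sum_walkCounts_eq (hf : IsFullCopy N G f) (hg : IsFullCopy M G g) (k : ℕ) :
    N.length = M.length ∧ (walkCounts N k).sum = (walkCounts M k).sum := by
  obtain ⟨e, he⟩ := hf.exists_equiv
  obtain ⟨e', he'⟩ := hg.exists_equiv
  have sum_eq (N : List ℕ) :
      (walkCounts N k).sum = ∑ i : Fin N.length, (walkCounts N k).getD i 0 := by
    rw [← Fin.sum_univ_getElem]
    exact Fintype.sum_equiv (finCongr (length_walkCounts N k)) _ _ fun i =>
      (List.getD_eq_getElem _ _ i.2).symm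
  refine ⟨by simpa using Fintype.card_congr (e.trans e'.symm), ?_⟩
  rw [sum_eq, sum_eq, ← (e.trans e'.symm).sum_comp]
  refine Finset.sum_congr rfl fun i _ => hf.walkCounts_eq hg (e.trans e'.symm) (fun i => ?_) k i
  rw [← he', ← he]
  simp

end Walks

section CopySearch

variable {vs : List Vtx}

/-- Whether bit `i` of `m` equals bit `j` of `n`. -/
def sameBit (m i n j : ℕ) : Bool :=
  Nat.beq (Nat.land (Nat.shiftRight m i) 1) (Nat.land (Nat.shiftRight n j) 1)

/-- Whether `v` differs from the vertices listed in `p` and has the adjacencies `s` to them. -/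
def fits (v : Vtx) (p : List ℕ) (s : ℕ) : Bool :=
  fold (fun q ih s => sel (Nat.beq q v.idx) false
      (andB (sameBit v.row q s 0) (forceNat (Nat.shiftRight s 1) ih)))
    (fun _ => true) p s

/-- Whether the vertices `p` extend to a copy of the graph with rows and labels `H`. -/
def hasCopyFrom (vs : List Vtx) (H : List (ℕ × ℕ)) (p : List ℕ) : Bool :=
  fold (fun h ih p => anyB (fun v => andB (Nat.beq v.label h.2)
      (andB (fits v p h.1) (ih (appB p [v.idx])))) vs)
    (fun _ => true) H p

/-- Whether the graph with vertices `vs` has an induced subgraph with rows and labels `H`. -/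
def hasCopy (vs : List Vtx) (H : List (ℕ × ℕ)) : Bool :=
  hasCopyFrom vs H []

theorem sameBit_iff {m i n j : ℕ} : sameBit m i n j = true ↔ bit m i = bit n j := by
  have hmod (n i : ℕ) : Nat.land (Nat.shiftRight n i) 1 = (bit n i).toNat := by
    rw [bit_eq, Nat.toNat_testBit, ← Nat.shiftRight_eq_div_pow]
    exact Nat.and_one_is_mod _
  rw [sameBit, Nat.beq_eq, hmod, hmod]
  cases bit m i <;> cases bit n j <;> decide

theorem fits_iff {v : Vtx} {p : List ℕ} {s : ℕ} : fits v p s = true ↔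
    ∀ j < p.length, p.getD j 0 ≠ v.idx ∧ bit v.row (p.getD j 0) = bit s j := by
  induction p generalizing s with
  | nil => simp [fits, fold]
  | cons q p ih =>
    have unfold_cons : fits v (q :: p) s =
        if Nat.beq q v.idx then false else sameBit v.row q s 0 && fits v p (s >>> 1) := by
      rw [← andB_eq, ← sel_eq]
      rfl
    rw [unfold_cons, List.length_cons, Nat.forall_lt_succ_left]
    simp only [Nat.beq_eq, Bool.if_false_left, Bool.and_eq_true, Bool.not_eq_true',
      decide_eq_false_iff_not, sameBit_iff, ih, bit_shiftRight, List.getD_cons_zero,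
      List.getD_cons_succ, Nat.add_comm 1, and_assoc]

theorem hasCopyFrom_iff {H : List (ℕ × ℕ)} {p : List ℕ} : hasCopyFrom vs H p = true ↔
    ∃ g : ℕ → Vtx, ∀ i < H.length, g i ∈ vs ∧ (g i).label = (H.getD i 0).2 ∧
      fits (g i) (p ++ (List.range i).map fun j => (g j).idx) (H.getD i 0).1 = true := by
  induction H generalizing p with
  | nil => exact iff_of_true rfl ⟨fun _ => ⟨0, 0, 0⟩, by simp⟩
  | cons h H ih =>
    have cons_iff : hasCopyFrom vs (h :: H) p = true ↔ ∃ v ∈ vs, v.label = h.2 ∧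
        fits v p h.1 = true ∧ hasCopyFrom vs H (p ++ [v.idx]) = true := by
      have unfold_cons : hasCopyFrom vs (h :: H) p = anyB (fun v => andB (Nat.beq v.label h.2)
          (andB (fits v p h.1) (hasCopyFrom vs H (appB p [v.idx])))) vs := rfl
      simp only [unfold_cons, anyB_eq, List.any_eq_true, andB_eq, appB_eq, Bool.and_eq_true,
        Nat.beq_eq]
    simp only [cons_iff, ih, List.length_cons, Nat.forall_lt_succ_left, List.getD_cons_zero,
      List.getD_cons_succ, List.range_zero, List.map_nil, List.append_nil,
      List.range_succ_eq_map, List.map_cons, List.map_map, List.append_assoc,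
      List.singleton_append]
    constructor
    · rintro ⟨v, hv, hl, hfit, g, hg⟩
      exact ⟨fun i => Nat.casesOn i v g, ⟨hv, hl, hfit⟩, hg⟩
    · rintro ⟨g, ⟨hv, hl, hfit⟩, hg⟩
      exact ⟨g 0, hv, hl, hfit, fun i => g (i + 1), hg⟩

theorem hasCopy_iff {H : List (ℕ × ℕ)} : hasCopy vs H = true ↔
    ∃ g : ℕ → Vtx, ∀ i < H.length, g i ∈ vs ∧ (g i).label = (H.getD i 0).2 ∧
      ∀ j < i, (g j).idx ≠ (g i).idx ∧ bit (g i).row (g j).idx = bit (H.getD i 0).1 j := by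
  rw [hasCopy, hasCopyFrom_iff]
  simp +contextual [fits_iff]

end CopySearch

section Refutation

/-- The adjacencies inside a list of vertices; those of the first vertex come last. -/
def word {α : Type*} (A : α → α → Bool) : List α → List Bool
  | [] => []
  | x :: l => word A l ++ l.map (A x)

/-- The words of all orderings of the graphs on five vertices in `Ls`. -/
def words (Ls : List (List ℕ)) : List (List Bool) :=
  (Ls.filter fun H => H.length == 5).flatMap fun H =>
    (List.range 5).permutations'.map (word (adj H))

/-- The tails of the words in `K` that start with `b`. -/
def descend (b : Bool) (K : List (List Bool)) : List (List Bool) :=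
  fold (fun τ r => List.rec r (fun c τ' _ => sel b (sel c (τ' :: r) r) (sel c r (τ' :: r))) τ) [] K

/-- `k K'`, where `K'` consists of the tails in `K` of the adjacency word of `v` to `chosen`. -/
def descends (v : Vtx) (chosen : List Vtx) (K : List (List Bool))
    (k : List (List Bool) → ℕ) : ℕ :=
  fold (fun u ih K => ih (sel (bit v.row u.idx) (descend true K) (descend false K))) k chosen K

/-- The number `x`, or `0` if `K` is empty. -/
def ifAny (K : List (List Bool)) (x : ℕ) : ℕ :=
  List.rec 0 (fun _ _ _ => x) K

/-- The mask of the `p` in `full` for which the `p`-th bits of the labels of `chosen` form a word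
in `K`. -/
def spelled (full : ℕ) (chosen : List Vtx) (K : List (List Bool)) : ℕ :=
  fold (fun v ih K => ifAny K (Nat.lor (Nat.land v.label (ih (descend true K)))
      (Nat.land (diff full v.label) (ih (descend false K)))))
    (fun K => sel (anyB List.isEmpty K) full 0) chosen K

/-- The mask of the types in `full` for which `chosen`, some `c` vertices from `rest` and a vertex
of this type have an adjacency word that ends in `K`; the word of `chosen` itself has been read
before. -/
def dead (full c : ℕ) (K : List (List Bool)) (chosen rest : List Vtx) : ℕ :=
  Nat.rec (motive := fun _ => List (List Bool) → List Vtx → List Vtx → ℕ)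
    (fun K chosen _ => spelled full chosen K)
    (fun _ ih K chosen rest => ifAny K (foldTails (fun v rest r =>
      Nat.lor (descends v chosen K fun K => ih K (v :: chosen) rest) r) 0 rest))
    c K chosen rest

section Words

variable {α β : Type*}

theorem word_map (A : β → β → Bool) (g : α → β) (l : List α) :
    word A (l.map g) = word (fun x y => A (g x) (g y)) l := by
  induction l with
  | nil => rfl
  | cons x l ih => simp [word, ih]

theorem word_congr {A B : α → α → Bool} {l : List α} (h : ∀ x ∈ l, ∀ y ∈ l, A x y = B x y) :
    word A l = word B l := by
  induction l with
  | nil => rfl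
  | cons x l ih =>
    rw [word, word, ih fun y hy z hz => h y (.tail _ hy) z (.tail _ hz)]
    exact congrArg _ (List.map_congr_left fun y hy => h x (.head _) y (.tail _ hy))

theorem length_word (A : α → α → Bool) (l : List α) : (word A l).length = l.length.choose 2 := by
  induction l with
  | nil => rfl
  | cons x l ih => simp [word, ih, Nat.choose_succ_succ' _ 1, Nat.add_comm]

theorem eq_getElem_of_word_eq {A : α → α → Bool} {B : β → β → Bool} {l : List α} {m : List β}
    (hlen : l.length = m.length) (h : word A l = word B m) {i j : ℕ} (hij : i < j)
    (hj : j < l.length) : A l[i] l[j] = B m[i] m[j] := by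
  induction l generalizing m i j with
  | nil => simp at hj
  | cons x l ih =>
    obtain _ | ⟨y, m⟩ := m
    · simp at hlen
    have hlen : l.length = m.length := by simpa using hlen
    obtain ⟨htail, hhead⟩ := List.append_inj h (by rw [length_word, length_word, hlen])
    obtain _ | j := j
    · simp at hij
    obtain _ | i := i
    · have hj : j < l.length := by simpa using hj
      simpa [hj, hlen ▸ hj] using congrArg (·[j]?) hhead
    · exact ih hlen htail (by omega) (by simpa using hj)

end Words

variable {V : Type*} {G : SimpleGraph V} {Ls : List (List ℕ)}

open Classical in
theorem exists_isCopy_of_word_mem (hLs : ∀ H ∈ Ls, IsGraph H) {l : List V} (hnd : l.Nodup)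
    (hl : l.length = 5) (h : word (fun x y => decide (G.Adj x y)) l ∈ words Ls) :
    ∃ H ∈ Ls, ∃ g, IsCopy H G g := by
  simp only [words, List.mem_flatMap, List.mem_filter, beq_iff_eq, List.mem_map,
    List.mem_permutations'] at h
  obtain ⟨H, ⟨hH, hH5⟩, σ, hσ, hw⟩ := h
  have hσl : σ.length = l.length := by simp [hσ.length_eq, hl]
  have mem_σ {i : ℕ} (hi : i < H.length) : i ∈ σ := hσ.mem_iff.2 (List.mem_range.2 (hH5 ▸ hi))
  have adj_iff {a b : ℕ} (ha : a < σ.length) (hb : b < σ.length) (hab : a < b) :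
      adj H σ[a] σ[b] = true ↔ G.Adj l[a] l[b] := by
    rw [eq_getElem_of_word_eq hσl hw hab hb, decide_eq_true_iff]
  have hlt {i : ℕ} (hi : i < H.length) : σ.idxOf i < σ.length :=
    List.idxOf_lt_length_iff.2 (mem_σ hi)
  have : Inhabited V := ⟨l[0]⟩
  refine ⟨H, hH, fun i => if hi : i < H.length then l[σ.idxOf i]'(hσl ▸ hlt hi) else default,
    (hLs H hH).isCopy fun i hi j hj => ?_⟩
  have hj' := hj.trans hi
  simp only [hi, hj', dif_pos]
  have hne : σ.idxOf i ≠ σ.idxOf j := fun h => hj.ne' ((List.idxOf_inj (mem_σ hi)).1 h)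
  refine ⟨fun h => hne (hnd.getElem_inj_iff.1 h), ?_⟩
  rcases hne.lt_or_gt with hab | hab
  · simpa using adj_iff (hlt hi) (hlt hj') hab
  · rw [G.adj_comm]
    exact ⟨fun h => (adj_iff (hlt hj') (hlt hi) hab).1 (by simpa using (hLs H hH i j h).2),
      fun h => (hLs H hH j i (by simpa using (adj_iff (hlt hj') (hlt hi) hab).2 h)).2⟩

theorem mem_descend {b : Bool} {τ : List Bool} {K : List (List Bool)} :
    τ ∈ descend b K ↔ b :: τ ∈ K := by
  induction K with
  | nil => exact iff_of_false List.not_mem_nil List.not_mem_nil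
  | cons σ K ih =>
    have unfold_cons : descend b (σ :: K) = List.rec (descend b K) (fun c τ' _ =>
        sel b (sel c (τ' :: descend b K) (descend b K)) (sel c (descend b K) (τ' :: descend b K)))
        σ := rfl
    rw [unfold_cons, List.mem_cons, ← ih]
    cases σ with
    | nil => simp
    | cons c σ => cases b <;> cases c <;> simp

theorem exists_descends_eq (v : Vtx) (chosen : List Vtx) (K : List (List Bool))
    (k : List (List Bool) → ℕ) : ∃ K', descends v chosen K k = k K' ∧
      ∀ τ, τ ∈ K' ↔ chosen.map (fun u => bit v.row u.idx) ++ τ ∈ K := by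
  induction chosen generalizing K with
  | nil => exact ⟨K, rfl, fun _ => Iff.rfl⟩
  | cons u chosen ih =>
    obtain ⟨K', hK', h⟩ := ih (descend (bit v.row u.idx) K)
    refine ⟨K', ?_, fun τ => (h τ).trans mem_descend⟩
    rw [← hK', descends, fold_cons, sel_eq]
    cases bit v.row u.idx <;> rfl

theorem bit_of_bit_ifAny {K : List (List Bool)} {x p : ℕ} (h : bit (ifAny K x) p = true) :
    bit x p = true := by
  cases K with
  | nil => exact absurd h (by simp [ifAny])
  | cons => exact h

theorem mem_of_bit_spelled {full p : ℕ} {chosen : List Vtx} {K : List (List Bool)}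
    (h : bit (spelled full chosen K) p = true) : chosen.map (fun v => bit v.label p) ∈ K := by
  induction chosen generalizing K with
  | nil =>
    have unfold_nil : spelled full [] K = sel (anyB List.isEmpty K) full 0 := rfl
    rw [unfold_nil, sel_eq] at h
    split_ifs at h with hK
    · simpa using hK
    · simp at h
  | cons v chosen ih =>
    have unfold_cons : spelled full (v :: chosen) K = ifAny K
        (v.label &&& spelled full chosen (descend true K) |||
          diff full v.label &&& spelled full chosen (descend false K)) := rfl
    have h := bit_of_bit_ifAny (unfold_cons ▸ h)
    simp only [bit_or, bit_and, bit_diff, Bool.or_eq_true, Bool.and_eq_true,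
      Bool.not_eq_true'] at h
    rw [List.map_cons]
    rcases h with ⟨hv, h⟩ | ⟨⟨-, hv⟩, h⟩ <;> rw [hv] <;> exact mem_descend.1 (ih h)

theorem exists_sublist_of_bit_dead {full c p : ℕ} {K : List (List Bool)} {chosen rest : List Vtx}
    (h : bit (dead full c K chosen rest) p = true) :
    ∃ l : List Vtx, l.Sublist rest ∧ l.length = c ∧ ∃ τ,
      word (fun u v => bit u.row v.idx) (l.reverse ++ chosen) =
        word (fun u v => bit u.row v.idx) chosen ++ τ ∧
      τ ++ (l.reverse ++ chosen).map (fun v => bit v.label p) ∈ K := by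
  induction c generalizing K chosen rest with
  | zero => exact ⟨[], List.nil_sublist _, rfl, [], by simp, mem_of_bit_spelled h⟩
  | succ c ih =>
    replace h := bit_of_bit_ifAny h
    induction rest with
    | nil => exact absurd h (by simp [foldTails])
    | cons v rest ih' =>
      rw [foldTails_cons, Nat.lor_eq, bit_or, Bool.or_eq_true] at h
      rcases h with h | h
      · obtain ⟨K', hK', hmem⟩ := exists_descends_eq v chosen K
          fun K => dead full c K (v :: chosen) rest
        obtain ⟨l, hl, hlen, τ, hw, hτ⟩ := ih (hK' ▸ h)
        refine ⟨v :: l, hl.cons_cons v, by simp [hlen],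
          chosen.map (fun u => bit v.row u.idx) ++ τ, ?_, ?_⟩
        · simpa [word] using hw
        · simpa using (hmem _).1 hτ
      · obtain ⟨l, hl, hrest⟩ := ih' h
        exact ⟨l, hl.cons v, hrest⟩

/-- `dead` for all `4`-subsets of `vs`. -/
def deadAll (full : ℕ) (K : List (List Bool)) (vs : List Vtx) : ℕ :=
  dead full 4 K [] vs.reverse

/-- `dead` for the `4`-subsets of `vs` that contain the last vertex. -/
def deadLast (full : ℕ) (K : List (List Bool)) (vs : List Vtx) : ℕ :=
  List.rec 0 (fun v rest _ => dead full 3 K [v] rest) vs.reverse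

theorem exists_sublist_of_bit_deadAll {full p : ℕ} {K : List (List Bool)} {vs : List Vtx}
    (h : bit (deadAll full K vs) p = true) : ∃ l : List Vtx, l.Sublist vs ∧ l.length = 4 ∧
      word (fun u v => bit u.row v.idx) l ++ l.map (fun v => bit v.label p) ∈ K := by
  obtain ⟨l, hl, hlen, τ, hw, hτ⟩ := exists_sublist_of_bit_dead h
  refine ⟨l.reverse, by simpa using hl.reverse, by simpa using hlen, ?_⟩
  simp only [List.append_nil, word, List.nil_append] at hw hτ
  rwa [hw]

theorem exists_sublist_of_bit_deadLast {full p : ℕ} {K : List (List Bool)} {vs : List Vtx}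
    (h : bit (deadLast full K vs) p = true) : ∃ l : List Vtx, l.Sublist vs ∧ l.length = 4 ∧
      word (fun u v => bit u.row v.idx) l ++ l.map (fun v => bit v.label p) ∈ K := by
  rw [deadLast] at h
  cases hvs : vs.reverse with
  | nil => exact absurd h (by simp [hvs])
  | cons v rest =>
    rw [hvs] at h
    obtain ⟨l, hl, hlen, τ, hw, hτ⟩ := exists_sublist_of_bit_dead h
    refine ⟨l.reverse ++ [v], ?_, by simp [hlen], ?_⟩
    · simpa [← hvs] using (hl.cons_cons v).reverse
    · rw [hw]
      exact hτ

open Classical in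
theorem exists_isCopy_of_sublist {N : List ℕ} {f : ℕ → V} {label : ℕ → ℕ} {w : V} {p : ℕ}
    (hLs : ∀ H ∈ Ls, IsGraph H) (hf : IsCopy N G f) (hw : ∀ i < N.length, f i ≠ w)
    (hlabel : ∀ i < N.length, bit (label i) p = true ↔ G.Adj (f i) w) {l : List Vtx}
    (hl : l.Sublist (vertices label N)) (hlen : l.length = 4)
    (h : word (fun u v => bit u.row v.idx) l ++ l.map (fun v => bit v.label p) ∈ words Ls) :
    ∃ H ∈ Ls, ∃ g, IsCopy H G g := by
  have represents {v : Vtx} (hv : v ∈ l) := hf.represents (hl.subset hv)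
  have vertices_idx : (vertices label N).map Vtx.idx = List.range N.length := by
    simp [vertices, Function.comp_def, List.zipIdx_map_snd, List.range_eq_range']
  have hnd : (w :: l.map fun v => f v.idx).Nodup := by
    refine List.nodup_cons.2 ⟨?_, ?_⟩
    · simp only [List.mem_map, not_exists, not_and]
      exact fun v hv => hw _ (represents hv).idx_lt
    · have hidx : (l.map Vtx.idx).Nodup :=
        (hl.map _).nodup (vertices_idx ▸ List.nodup_range)
      refine (List.map_map (f := Vtx.idx) (g := f) ▸ hidx.map_on fun i hi j hj hij => ?_ :)
      simp only [List.mem_map] at hi hj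
      obtain ⟨⟨u, hu, rfl⟩, v, hv, rfl⟩ := And.intro hi hj
      exact hf.injOn (represents hu).idx_lt (represents hv).idx_lt hij
  refine exists_isCopy_of_word_mem hLs hnd (by simp [hlen]) ?_
  rw [word, word_map, List.map_map]
  convert h using 2
  · refine word_congr fun u hu v hv => ?_
    rw [Bool.eq_iff_iff, decide_eq_true_iff, (represents hu).bit_row,
      and_iff_right (represents hv).idx_lt]
  · refine List.map_congr_left fun v hv => ?_
    obtain ⟨i, hi, rfl⟩ := mem_vertices.1 (hl.subset hv)
    simp [G.adj_comm w, ← hlabel i hi]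

end Refutation

section Rules

/-- `List.flatMap`. -/
def flatMapB {α β : Type} (g : α → List β) (l : List α) : List β :=
  fold (fun a r => appB (g a) r) [] l

/-- The mask of the `p` for which `i` belongs to the mask `T[p]`. -/
def column (T : List ℕ) (i : ℕ) : ℕ :=
  fold (fun s r => Nat.add (sel (bit s i) 1 0) (Nat.mul 2 r)) 0 T

/-- The union of the masks `g v` for `v` in `vs`. -/
def unionMask (g : Vtx → ℕ) (vs : List Vtx) : ℕ :=
  fold (fun v m => Nat.lor (g v) m) 0 vs

/-- Whether the mask `m` has fewer elements than `n`; only the first twelve are counted. -/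
def fewer (m n : ℕ) : Bool :=
  Nat.rec (motive := fun _ => ℕ → ℕ → Bool) (fun _ _ => false)
    (fun _ ih m n => sel (isZero n) false (sel (isZero m) true
      (forceNat (dropTop m) fun m => forceNat (dropTop n) fun n => ih m n))) 12 m n

/-- A smallest mask among `b` and the entries of `l`. -/
def smallest (l : List ℕ) (b : ℕ) : ℕ :=
  fold (fun a ih b => sel (isZero b) b (forceNat a fun a => ih (sel (fewer a b) a b)))
    (fun b => b) l b

/-- Each vertex of degree at most `k` in the copy has another neighbour; the masks of the types of
these neighbours. -/
def degreeMasks (k : ℕ) (vs : List Vtx) : List ℕ :=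
  fold (fun v r => sel (isZero (dropTops k v.row)) (v.label :: r) r) [] vs

/-- The `c`-cliques in `vs`. -/
def cliques (c : ℕ) (vs : List Vtx) : List (List Vtx) :=
  Nat.rec (motive := fun _ => List Vtx → List (List Vtx)) (fun _ => [[]])
    (fun _ ih vs => foldTails (fun v rest r => appB
      (mapB (fun l => v :: l) (ih (filterB (fun u => bit v.row u.idx) rest))) r) [] vs) c vs

/-- The vertices of `as` are to be mapped to a clique outside the mask `A` that extends `bs`, each
in such a way that its neighbours outside `A` stay neighbours. Each such map yields the mask of the
types that keep a vertex from doing so, added to `m`. -/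
def imageMasks (vs : List Vtx) (A : ℕ) (as bs : List Vtx) (m : ℕ) : List ℕ :=
  fold (fun a ih bs m => forceNat (diff a.row A) fun out =>
      flatMapB (fun b => ih (b :: bs) (Nat.lor m (diff a.label b.label)))
        (filterB (fun b => andB (isZero (diff out b.row))
          (andB (not (bit A b.idx)) (allB (fun b' => bit b'.row b.idx) bs))) vs))
    (fun _ m => [m]) as bs m

/-- The masks of `imageMasks` for all `c`-cliques. -/
def cliqueMasks (c : ℕ) (vs : List Vtx) : List ℕ :=
  flatMapB (fun as => imageMasks vs (unionMask (fun v => Nat.pow 2 v.idx) as) as [] 0)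
    (cliques c vs)

/-- A small set of types in `alive` one of which must be realised. -/
def branchMask (k : ℕ) (vs : List Vtx) (alive : ℕ) : ℕ :=
  fold (fun c ih b => sel (isZero (dropTops 2 b)) b
      (forceNat (smallest (mapB (Nat.land alive) (cliqueMasks c vs)) b) ih))
    (fun b => b) [2, 3, 4] <|
  smallest (mapB (Nat.land alive) (appB (degreeMasks k vs) (cliqueMasks 1 vs)))
    (Nat.land alive (unionMask Vtx.label vs))

@[simp] theorem flatMapB_eq {α β : Type} (g : α → List β) (l : List α) :
    flatMapB g l = l.flatMap g := by
  induction l with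
  | nil => rfl
  | cons a l ih => rw [flatMapB, fold_cons, appB_eq, List.flatMap_cons, ← ih, flatMapB]

theorem bit_column (T : List ℕ) (i p : ℕ) : bit (column T i) p = bit (T.getD p 0) i := by
  induction T generalizing p with
  | nil => simp [column, fold]
  | cons s T ih =>
    have unfold_cons : column (s :: T) i = (bit s i).toNat + 2 * column T i := by
      rw [column, fold_cons, sel_eq]
      cases bit s i <;> rfl
    cases p with
    | zero => cases h : bit s i <;> simp [unfold_cons, h, bit_eq (_ + _), bit_eq (_ * _)]
    | succ p =>
      rw [List.getD_cons_succ, ← ih, unfold_cons, bit_eq (_ + _), Nat.testBit_succ]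
      cases bit s i <;> simp [Nat.add_div_of_dvd_left, bit_eq]

theorem bit_unionMask {g : Vtx → ℕ} {vs : List Vtx} {i : ℕ} :
    bit (unionMask g vs) i = true ↔ ∃ v ∈ vs, bit (g v) i = true := by
  induction vs with
  | nil => simp [unionMask, fold]
  | cons v vs ih =>
    have unfold_cons : unionMask g (v :: vs) = g v ||| unionMask g vs := rfl
    simp [unfold_cons, ih]

theorem smallest_mem (l : List ℕ) (b : ℕ) : smallest l b ∈ b :: l := by
  induction l generalizing b with
  | nil => exact .head _
  | cons a l ih =>
    have unfold_cons : smallest (a :: l) b =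
        if isZero b then b else smallest l (if fewer a b then a else b) := by
      rw [← sel_eq, ← sel_eq]
      rfl
    have ha := ih a
    have hb := ih b
    simp only [unfold_cons, List.mem_cons] at ha hb ⊢
    split_ifs <;> tauto

theorem mem_degreeMasks {k m : ℕ} {vs : List Vtx} (hm : m ∈ degreeMasks k vs) :
    ∃ v ∈ vs, isZero (dropTops k v.row) = true ∧ v.label = m := by
  induction vs with
  | nil => cases hm
  | cons v vs ih =>
    rw [degreeMasks, fold_cons, sel_eq] at hm
    split_ifs at hm with h
    · rcases List.mem_cons.1 hm with rfl | hm
      · exact ⟨v, .head _, h, rfl⟩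
      · exact (ih hm).imp fun u hu => ⟨.tail _ hu.1, hu.2⟩
    · exact (ih hm).imp fun u hu => ⟨.tail _ hu.1, hu.2⟩

theorem of_mem_cliques {c : ℕ} {vs l : List Vtx} (hl : l ∈ cliques c vs) :
    l.length = c ∧ l.Sublist vs ∧ l.Pairwise fun u v => bit u.row v.idx = true := by
  induction c generalizing vs l with
  | zero =>
    obtain rfl := List.mem_singleton.1 hl
    exact ⟨rfl, List.nil_sublist _, .nil⟩
  | succ c ih =>
    induction vs with
    | nil => cases hl
    | cons v vs ih' =>
      have unfold_cons : cliques (c + 1) (v :: vs) = appB (mapB (fun l => v :: l)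
        (cliques c (filterB (fun u => bit v.row u.idx) vs))) (cliques (c + 1) vs) := rfl
      simp only [unfold_cons, appB_eq, mapB_eq, filterB_eq, List.mem_append, List.mem_map] at hl
      rcases hl with ⟨l, hl, rfl⟩ | hl
      · obtain ⟨hlen, hsub, hpw⟩ := ih hl
        refine ⟨by rw [List.length_cons, hlen], (hsub.trans List.filter_sublist).cons_cons v,
          .cons (fun u hu => ?_) hpw⟩
        exact (List.mem_filter.1 (hsub.subset hu)).2
      · obtain ⟨hlen, hsub, hpw⟩ := ih' hl
        exact ⟨hlen, hsub.cons v, hpw⟩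

theorem exists_of_mem_imageMasks {vs as bs : List Vtx} {A m m' : ℕ}
    (hm' : m' ∈ imageMasks vs A as bs m) : ∃ l : List (Vtx × Vtx), l.map Prod.fst = as ∧
      (∀ q ∈ l, q.2 ∈ vs ∧ bit A q.2.idx = false ∧
        ∀ i, bit q.1.row i = true → bit A i = false → bit q.2.row i = true) ∧
      (∀ b ∈ bs, ∀ q ∈ l, bit b.row q.2.idx = true) ∧
      (l.Pairwise fun q r => bit q.2.row r.2.idx = true) ∧
      ∀ p, bit m p = true ∨ (∃ q ∈ l, bit q.1.label p = true ∧ bit q.2.label p = false) →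
        bit m' p = true := by
  induction as generalizing bs m with
  | nil =>
    obtain rfl := List.mem_singleton.1 hm'
    exact ⟨[], by simp⟩
  | cons a as ih =>
    have unfold_cons : imageMasks vs A (a :: as) bs m =
        flatMapB (fun b => imageMasks vs A as (b :: bs) (Nat.lor m (diff a.label b.label)))
          (filterB (fun b => andB (isZero (diff (diff a.row A) b.row))
            (andB (not (bit A b.idx)) (allB (fun b' => bit b'.row b.idx) bs))) vs) := rfl
    simp only [unfold_cons, flatMapB_eq, filterB_eq, List.mem_flatMap, List.mem_filter, andB_eq,
      allB_eq, Bool.and_eq_true, isZero_iff, bit_diff, Bool.not_eq_true', List.all_eq_true] at hm'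
    obtain ⟨b, ⟨hb, hrow, hA, hbs⟩, hm'⟩ := hm'
    obtain ⟨l, rfl, hl, hcl, hpw, hmask⟩ := ih hm'
    refine ⟨(a, b) :: l, rfl, ?_, ?_, .cons (hcl b (.head _)) hpw, fun p hp => hmask p ?_⟩
    · refine List.forall_mem_cons.2 ⟨⟨hb, hA, fun i hi hiA => ?_⟩, hl⟩
      simpa [hi, hiA] using hrow i
    · exact fun b' hb' => List.forall_mem_cons.2 ⟨hbs b' hb', hcl b' (.tail _ hb')⟩
    · simp only [List.exists_mem_cons_iff] at hp
      simp only [Nat.lor_eq, bit_or, bit_diff, Bool.or_eq_true, Bool.and_eq_true,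
        Bool.not_eq_true', or_assoc]
      exact hp

theorem exists_of_mem_cliqueMasks {vs : List Vtx} {c m : ℕ} (hc : c ≠ 0)
    (hm : m ∈ cliqueMasks c vs) : ∃ l : List (Vtx × Vtx), l ≠ [] ∧
      (∀ q ∈ l, q.1 ∈ vs ∧ q.2 ∈ vs ∧ ∀ r ∈ l, r.1.idx ≠ q.2.idx) ∧
      (∀ q ∈ l, ∀ i, bit q.1.row i = true → (∀ r ∈ l, r.1.idx ≠ i) → bit q.2.row i = true) ∧
      (l.Pairwise fun q r => bit q.1.row r.1.idx = true ∧ bit q.2.row r.2.idx = true) ∧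
      ∀ p, (∃ q ∈ l, bit q.1.label p = true ∧ bit q.2.label p = false) → bit m p = true := by
  rw [cliqueMasks, flatMapB_eq, List.mem_flatMap] at hm
  obtain ⟨as, has, hm⟩ := hm
  obtain ⟨hlen, hsub, hpw⟩ := of_mem_cliques has
  obtain ⟨l, rfl, hl, -, hcl, hmask⟩ := exists_of_mem_imageMasks hm
  have bit_mask {i : ℕ} :
      bit (unionMask (fun v => Nat.pow 2 v.idx) (l.map Prod.fst)) i = false ↔
        ∀ r ∈ l, r.1.idx ≠ i := by
    rw [Bool.eq_false_iff, Ne, bit_unionMask]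
    simp
  refine ⟨l, ?_, fun q hq => ⟨hsub.subset (List.mem_map_of_mem hq), (hl q hq).1,
    bit_mask.1 (hl q hq).2.1⟩, fun q hq i hi hiA => (hl q hq).2.2 i hi (bit_mask.2 hiA),
    (List.pairwise_map.1 hpw).and hcl, fun p hp => hmask p (.inr hp)⟩
  rintro rfl
  exact hc hlen.symm

variable {V : Type*} {G : SimpleGraph V} {N T : List ℕ} {f : ℕ → V} {k : ℕ}

/-- A node of the search: a copy of the graph encoded by `N`, and a list `T` of the types that the
remaining vertices of `G` may have, where the type of `w` is the mask of its neighbours in the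
copy. -/
structure IsNode (N T : List ℕ) (G : SimpleGraph V) (f : ℕ → V) : Prop extends
    IsCopy N G f where
  exists_type : ∀ w, (∀ i < N.length, f i ≠ w) → ∃ s ∈ T, Realizes G f N.length w s

/-- The vertex `w` lies outside the copy and has the `p`-th type in `T`. -/
structure HasType (N T : List ℕ) (G : SimpleGraph V) (f : ℕ → V) (p : ℕ) (w : V) : Prop where
  lt_length : p < T.length
  ne : ∀ i < N.length, f i ≠ w
  realizes : Realizes G f N.length w (T.getD p 0)

/-- Some vertex has a type in the mask `m`. -/
def Hits (N T : List ℕ) (G : SimpleGraph V) (f : ℕ → V) (m : ℕ) : Prop :=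
  ∃ p w, HasType N T G f p w ∧ bit m p = true

theorem HasType.bit_column_iff {p : ℕ} {w : V} (hw : HasType N T G f p w) {i : ℕ}
    (hi : i < N.length) : bit (column T i) p = true ↔ G.Adj (f i) w := by
  rw [bit_column, hw.realizes, and_iff_right hi]

theorem IsNode.exists_hasType (h : IsNode N T G f) {w : V} (hw : ∀ i < N.length, f i ≠ w) :
    ∃ p, HasType N T G f p w := by
  obtain ⟨s, hs, hr⟩ := h.exists_type w hw
  obtain ⟨p, hp, rfl⟩ := List.getElem_of_mem hs
  exact ⟨p, hp, hw, by rwa [List.getD_eq_getElem]⟩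

/-- The vertices of the copy, labelled by the types that are adjacent to them. -/
def nodeVertices (N T : List ℕ) : List Vtx :=
  vertices (column T) N

theorem HasType.bit_label_iff {p : ℕ} {w : V} (hw : HasType N T G f p w) {v : Vtx}
    (hv : v ∈ nodeVertices N T) : bit v.label p = true ↔ G.Adj (f v.idx) w := by
  obtain ⟨i, hi, rfl⟩ := mem_vertices.1 hv
  exact hw.bit_column_iff hi

theorem IsNode.hits_of_mem_degreeMasks (h : IsNode N T G f) (hG : IsVertexCritical (k + 2) G)
    {m : ℕ} (hm : m ∈ degreeMasks k (nodeVertices N T)) : Hits N T G f m := by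
  classical
  obtain ⟨v, hv, hdeg, rfl⟩ := mem_degreeMasks hm
  obtain ⟨s, hs, hrow⟩ := exists_card_le_of_dropTops hdeg
  obtain ⟨w, hw, hadj⟩ := hG.exists_adj_notMem (f v.idx) (s := s.image f)
    (Finset.card_image_le.trans_lt (Nat.lt_succ_of_le hs))
  have hout : ∀ i < N.length, f i ≠ w := by
    rintro i hi rfl
    have hi : bit v.row i = true := ((h.represents hv).bit_row i).2 ⟨hi, hadj⟩
    exact hw (Finset.mem_image_of_mem f (hrow i hi))
  obtain ⟨p, hp⟩ := h.exists_hasType hout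
  exact ⟨p, w, hp, (hp.bit_label_iff hv).2 hadj⟩

theorem IsNode.hits_of_mem_cliqueMasks (h : IsNode N T G f) (hG : IsVertexCritical (k + 1) G)
    {c m : ℕ} (hc : c ≠ 0) (hm : m ∈ cliqueMasks c (nodeVertices N T)) : Hits N T G f m := by
  obtain ⟨l, hl, hvs, hrow, hpw, hmask⟩ := exists_of_mem_cliqueMasks hc hm
  have adj_of_bit {u v : Vtx} (hu : u ∈ nodeVertices N T) (huv : bit u.row v.idx = true) :
      G.Adj (f u.idx) (f v.idx) := (((h.represents hu).bit_row _).1 huv).2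
  have adj_of_ne {q r : Vtx × Vtx} (hq : q ∈ l) (hr : r ∈ l) (hqr : q ≠ r) :
      G.Adj (f q.1.idx) (f r.1.idx) ∧ G.Adj (f q.2.idx) (f r.2.idx) := by
    let R (q r : Vtx × Vtx) : Prop :=
      G.Adj (f q.1.idx) (f r.1.idx) ∧ G.Adj (f q.2.idx) (f r.2.idx)
    have : Std.Symm R := ⟨fun _ _ h => ⟨h.1.symm, h.2.symm⟩⟩
    refine List.Pairwise.forall (R := R) (hpw.imp_of_mem fun {q r} hq _ hqr => ?_) hq hr hqr
    exact ⟨adj_of_bit (hvs q hq).1 hqr.1, adj_of_bit (hvs q hq).2.1 hqr.2⟩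
  have : Nonempty {q // q ∈ l} := nonempty_subtype.2 (List.exists_mem_of_ne_nil l hl)
  obtain ⟨⟨q, hq⟩, w, hw, haw, hbw⟩ := hG.exists_adj_not_adj (ι := {q // q ∈ l})
    (a := fun q => f q.1.1.idx) (b := fun q => f q.1.2.idx)
    (fun q r hqr => Subtype.ext <| by_contra fun hne => (adj_of_ne q.2 r.2 hne).1.ne hqr)
    (fun q ⟨r, hrq⟩ => (hvs q q.2).2.2 r r.2 <|
      h.injOn (h.represents (hvs r r.2).1).idx_lt (h.represents (hvs q q.2).2.1).idx_lt hrq)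
    (fun q r hqr => (adj_of_ne q.2 r.2 fun hqr' => hqr.ne (by rw [hqr'])).2)
  obtain ⟨hq₁, hq₂, -⟩ := hvs q hq
  have hout : ∀ i < N.length, f i ≠ w := by
    rintro i hi rfl
    have hiq : bit q.1.row i = true := ((h.represents hq₁).bit_row i).2 ⟨hi, haw⟩
    refine hbw (((h.represents hq₂).bit_row i).1 (hrow q hq i hiq ?_)).2
    rintro r hr rfl
    exact hw ⟨⟨r, hr⟩, rfl⟩
  obtain ⟨p, hp⟩ := h.exists_hasType hout
  refine ⟨p, w, hp, hmask p ⟨q, hq, (hp.bit_label_iff hq₁).2 haw, ?_⟩⟩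
  rwa [Bool.eq_false_iff, Ne, hp.bit_label_iff hq₂]

theorem Hits.land {m alive : ℕ} (hm : Hits N T G f m)
    (halive : ∀ p w, HasType N T G f p w → bit alive p = true) :
    Hits N T G f (Nat.land alive m) := by
  obtain ⟨p, w, hp, hm⟩ := hm
  exact ⟨p, w, hp, by simp [halive p w hp, hm]⟩

theorem hits_smallest {l : List ℕ} {b : ℕ} (hl : ∀ m ∈ l, Hits N T G f m)
    (hb : Hits N T G f b) : Hits N T G f (smallest l b) := by
  rcases List.mem_cons.1 (smallest_mem l b) with h | h
  · rwa [h]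
  · exact hl _ h

theorem IsNode.hits_of_colorable (h : IsNode N T G f) (hG : IsVertexCritical (k + 1) G)
    (hN : N ≠ []) (hcol : colourable k (nodeVertices N T) = true) :
    Hits N T G f (unionMask Vtx.label (nodeVertices N T)) := by
  have hmem {i : ℕ} (hi : i < N.length) : ∃ v ∈ nodeVertices N T, v.idx = i :=
    ⟨_, mem_vertices.2 ⟨i, hi, rfl⟩, rfl⟩
  obtain ⟨v, hv, -⟩ := hmem (List.length_pos_of_ne_nil hN)
  obtain ⟨-, ⟨u, hu, rfl⟩, w, hw, hadj⟩ := hG.exists_adj_of_colorable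
    (S := {x | ∃ v ∈ nodeVertices N T, f v.idx = x}) ⟨f v.idx, v, hv, rfl⟩
    ((colourable_iff fun _ => h.represents).1 hcol)
  obtain ⟨p, hp⟩ := h.exists_hasType (w := w) fun i hi hiw => by
    obtain ⟨v, hv, rfl⟩ := hmem hi
    exact hw ⟨v, hv, hiw⟩
  exact ⟨p, w, hp, bit_unionMask.2 ⟨u, hu, (hp.bit_label_iff hu).2 hadj⟩⟩

theorem IsNode.hits_branchMask (h : IsNode N T G f) (hG : IsVertexCritical (k + 2) G)
    (hN : N ≠ []) (hcol : colourable (k + 1) (nodeVertices N T) = true) {alive : ℕ}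
    (halive : ∀ p w, HasType N T G f p w → bit alive p = true) :
    Hits N T G f (branchMask k (nodeVertices N T) alive) := by
  have hits_of_mem {c : ℕ} (hc : c ≠ 0) :
      ∀ m ∈ mapB (Nat.land alive) (cliqueMasks c (nodeVertices N T)), Hits N T G f m := by
    rw [mapB_eq]
    simp only [List.forall_mem_map]
    exact fun m hm => (h.hits_of_mem_cliqueMasks hG hc hm).land halive
  have hits_fold (cs : List ℕ) (hcs : ∀ c ∈ cs, c ≠ 0) {b : ℕ} (hb : Hits N T G f b) :
      Hits N T G f (fold (fun c ih b => sel (isZero (dropTops 2 b)) b (forceNat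
        (smallest (mapB (Nat.land alive) (cliqueMasks c (nodeVertices N T))) b) ih))
        (fun b => b) cs b) := by
    induction cs generalizing b with
    | nil => exact hb
    | cons c cs ih =>
      rw [fold_cons, sel_eq]
      split_ifs
      · exact hb
      · exact ih (fun c hc => hcs c (.tail _ hc))
          (hits_smallest (hits_of_mem (hcs c (.head _))) hb)
  refine hits_fold [2, 3, 4] (by decide) (hits_smallest ?_ <|
    (h.hits_of_colorable hG hN hcol).land halive)
  rw [mapB_eq, appB_eq]
  simp only [List.forall_mem_map, List.mem_append]
  rintro m (hm | hm)
  · exact (h.hits_of_mem_degreeMasks hG hm).land halive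
  · exact (h.hits_of_mem_cliqueMasks hG one_ne_zero hm).land halive

end Rules

section Search

/-- The vertices `vs` without `v`. -/
def without (v : Vtx) (vs : List Vtx) : List Vtx :=
  filterB (fun u => not (Nat.beq u.idx v.idx)) vs

/-- Whether the graph with rows `N` and vertices `vs` cannot be all of a `(k + 2)`-critical graph
without an induced subgraph in `Ls`. The labels only serve to find a graph of `Ls` fast if it is
isomorphic to the given one. -/
def refutes (k : ℕ) (Ls : List (List ℕ)) (N : List ℕ) (vs : List Vtx) : Bool :=
  orB (forceList (walkCounts N 3) fun c => forceVertices (vertices (c.getD · 0) N) fun us =>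
      anyB (fun H => hasCopy us (H.zip (walkCounts H 3))) Ls) <|
  orB (not (appB (degreeMasks k vs) (cliqueMasks 1 vs)).isEmpty) <|
  anyB (fun v => not (colourable (k + 1) (without v vs))) vs

/-- The entries of `T` whose index belongs to the mask `m`. -/
def select (m : ℕ) (T : List ℕ) : List ℕ :=
  mapB Prod.fst (filterB (fun q => bit m q.2) T.zipIdx)

/-- The types over a copy with one more vertex, numbered `n`. -/
def double (n : ℕ) (T : List ℕ) : List ℕ :=
  appB (mapB (fun t => Nat.lor t (Nat.pow 2 n)) T) T

/-- Whether `next` accepts the extension of `N` by a vertex of type `s`, for each `s` in `S`; the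
other types are those of `O` and those not yet treated. -/
def branch (next : List ℕ → List ℕ → Bool) (N S O : List ℕ) : Bool :=
  foldTails (fun s S r => andB (forceList (extend N s) fun N' =>
    forceList (double N.length (s :: appB S O)) fun T' => next N' T') r) true S

/-- A node is refuted if it cannot be all of `G`, or if `next` accepts the nodes it branches into.
Here `K` lists the words of `Ls`; types excluded by four vertices other than the last one are
assumed to be absent from `T`. -/
def searchStep (k : ℕ) (Ls : List (List ℕ)) (K : List (List Bool))
    (next : List ℕ → List ℕ → Bool) (N T : List ℕ) : Bool :=
  forceVertices (nodeVertices N T) fun vs =>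
  forceNat (Nat.sub (Nat.pow 2 T.length) 1) fun full =>
  sel (colourable (k + 1) vs)
    (forceNat (diff full (deadLast full K vs)) fun alive =>
      forceNat (branchMask k vs alive) fun m =>
      forceList (select m T) fun S =>
      forceList (select (diff alive m) T) fun O => branch next N S O)
    (refutes k Ls N vs)

/-- Whether the node `N`, `T` does not occur in a `(k + 2)`-critical graph without induced subgraph
in `Ls`; a bound `fuel` on the number of added vertices makes this a structural recursion. -/
def search (k : ℕ) (Ls : List (List ℕ)) (K : List (List Bool)) (fuel : ℕ) :
    List ℕ → List ℕ → Bool :=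
  Nat.rec (fun _ _ => false) (fun _ next => searchStep k Ls K next) fuel

/-- Whether no `(k + 2)`-critical graph without induced subgraph in `Ls` contains the graph encoded
by `R`. -/
def eliminates (k : ℕ) (Ls : List (List ℕ)) (R : List ℕ) : Bool :=
  forceBy forceList Ls fun Ls =>
  forceList (List.range (Nat.pow 2 R.length)).reverse fun T =>
  forceVertices (nodeVertices R T) fun vs =>
  forceNat (Nat.sub (Nat.pow 2 T.length) 1) fun full =>
  forceList (select (diff full (deadAll full (words Ls) vs)) T) fun T =>
  search k Ls (words Ls) 20 R T

/-- Whether the graphs `Rs` can be eliminated one after the other, each being added to `Ls`. -/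
def eliminatesAll (k : ℕ) (Rs Ls : List (List ℕ)) : Bool :=
  fold (fun R ih Ls => andB (eliminates k Ls R) (ih (R :: Ls))) (fun _ => true) Rs Ls

theorem mem_select {m s : ℕ} {T : List ℕ} :
    s ∈ select m T ↔ ∃ p < T.length, bit m p = true ∧ T.getD p 0 = s := by
  simp only [select, mapB_eq, filterB_eq, List.mem_map, List.mem_filter, Prod.exists,
    List.mk_mem_zipIdx_iff_getElem?]
  constructor
  · rintro ⟨s, p, ⟨hp, hm⟩, rfl⟩
    obtain ⟨hlt, rfl⟩ := List.getElem?_eq_some_iff.1 hp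
    exact ⟨p, hlt, hm, List.getD_eq_getElem _ _ hlt⟩
  · rintro ⟨p, hp, hm, rfl⟩
    exact ⟨_, p, ⟨List.getElem?_eq_getElem hp, hm⟩, (List.getD_eq_getElem _ _ hp).symm⟩

variable {V : Type*} {G : SimpleGraph V} {k : ℕ} {Ls : List (List ℕ)} {N T : List ℕ} {f : ℕ → V}

theorem exists_isCopy_of_hasCopy {label : ℕ → ℕ} {H : List ℕ} (hH : IsGraph H)
    (hf : IsCopy N G f) {c : List ℕ} (hc : c.length = H.length)
    (h : hasCopy (vertices label N) (H.zip c) = true) : ∃ g, IsCopy H G g := by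
  obtain ⟨g, hg⟩ := hasCopy_iff.1 h
  simp only [List.length_zip, hc, min_self] at hg
  have represents {i : ℕ} (hi : i < H.length) := hf.represents (hg i hi).1
  refine ⟨fun i => f (g i).idx, hH.isCopy fun i hi j hj => ?_⟩
  obtain ⟨hne, hbit⟩ := (hg i hi).2.2 j hj
  have hji := (represents (hj.trans hi)).idx_lt
  refine ⟨fun h => hne (hf.injOn hji (represents hi).idx_lt h.symm), ?_⟩
  have hrow : bit (H.getD i 0) j = bit (g i).row (g j).idx := by
    rw [hbit, List.getD_eq_getElem (H.zip c) _ (by simpa [hc] using hi), List.getElem_zip,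
      List.getD_eq_getElem _ _ hi]
  rw [adj, hrow, (represents hi).bit_row, and_iff_right hji]

theorem IsNode.exists_eq_of_not_colourable (h : IsNode N T G f)
    (hG : IsVertexCritical (k + 1) G) {vs : List Vtx} (hvs : ∀ v ∈ vs, v ∈ nodeVertices N T)
    (hcol : colourable k vs = false) (x : V) :
    ∃ v ∈ vs, f v.idx = x := by
  suffices hS : {x | ∃ v ∈ vs, f v.idx = x} = Set.univ from Set.eq_univ_iff_forall.1 hS x
  by_contra hS
  rw [(colourable_iff fun v hv => h.represents (hvs v hv)).2 (hG.colorable_induce hS)] at hcol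
  cases hcol

theorem IsNode.exists_isCopy_of_refutes (h : IsNode N T G f) (hG : IsVertexCritical (k + 2) G)
    (hLs : ∀ H ∈ Ls, IsGraph H) (hcol : colourable (k + 1) (nodeVertices N T) = false)
    (href : refutes k Ls N (nodeVertices N T) = true) : ∃ H ∈ Ls, ∃ g, IsCopy H G g := by
  have not_hits (m : ℕ) : ¬ Hits N T G f m := by
    rintro ⟨p, w, hp, -⟩
    obtain ⟨v, hv, hvw⟩ := h.exists_eq_of_not_colourable hG (fun _ => id) hcol w
    exact hp.ne _ (h.represents hv).idx_lt hvw
  simp only [refutes, orB_eq, anyB_eq, appB_eq, forceList_eq, forceVertices_eq, Bool.or_eq_true,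
    List.any_eq_true, Bool.not_eq_true'] at href
  rcases href with ⟨H, hH, hcopy⟩ | hne | ⟨v, hv, hcol'⟩
  · exact ⟨H, hH, exists_isCopy_of_hasCopy (hLs H hH) h.toIsCopy (length_walkCounts H 3) hcopy⟩
  · obtain ⟨m, hm⟩ := List.exists_mem_of_ne_nil _ (List.isEmpty_eq_false_iff.1 hne)
    rcases List.mem_append.1 hm with hm | hm
    · exact (not_hits m (h.hits_of_mem_degreeMasks hG hm)).elim
    · exact (not_hits m (h.hits_of_mem_cliqueMasks hG one_ne_zero hm)).elim
  · simp only [without, filterB_eq] at hcol'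
    obtain ⟨u, hu, huv⟩ := h.exists_eq_of_not_colourable hG
      (fun u hu => (List.mem_filter.1 hu).1) hcol' (f v.idx)
    rw [List.mem_filter] at hu
    have hidx := h.injOn (h.represents hu.1).idx_lt (h.represents hv).idx_lt huv
    simp [hidx] at hu

theorem IsNode.extend (h : IsNode N T G f) {s : ℕ} {w : V}
    (hw : ∀ i < N.length, f i ≠ w) (hs : Realizes G f N.length w s) :
    IsNode (extend N s) (double N.length T) G (Function.update f N.length w) := by
  classical
  have update_eq {i : ℕ} (hi : i < N.length) : Function.update f N.length w i = f i :=
    Function.update_of_ne hi.ne _ _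
  have update_self : Function.update f N.length w N.length = w := Function.update_self ..
  have hlen : (CriticalSearch.extend N s).length = N.length + 1 := by
    simp [CriticalSearch.extend]
  refine ⟨(h.toIsCopy.congr fun i => update_eq).extend ?_ ?_, fun x hx => ?_⟩
  · intro i
    rw [hs i, update_self]
    exact and_congr_right fun hi => by rw [update_eq hi]
  · intro i hi
    rw [update_self, update_eq hi]
    exact hw i hi
  rw [hlen] at hx ⊢
  obtain ⟨t, ht, hr⟩ := h.exists_type x fun i hi =>
    update_eq hi ▸ hx i (hi.trans (Nat.lt_succ_self _))
  simp only [double, appB_eq, mapB_eq, List.mem_append, List.mem_map]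
  have bit_iff (i : ℕ) : i < N.length + 1 ∧ G.Adj (Function.update f N.length w i) x ↔
      bit t i = true ∨ N.length = i ∧ G.Adj w x := by
    rw [Nat.lt_succ_iff_lt_or_eq, or_and_right, hr i]
    refine or_congr (and_congr_right fun hi => by rw [update_eq hi]) ?_
    rw [eq_comm]
    exact and_congr_right fun hi => by rw [← hi, update_self]
  by_cases hwx : G.Adj w x
  · exact ⟨_, .inl ⟨t, ht, rfl⟩, fun i => (by simp [hwx] : _ ↔ _).trans (bit_iff i).symm⟩
  · exact ⟨t, .inr ht, fun i => (by simp [hwx] : _ ↔ _).trans (bit_iff i).symm⟩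

theorem IsNode.exists_of_branch {next : List ℕ → List ℕ → Bool} {S O : List ℕ}
    (h : IsNode N (S ++ O) G f) {w : V} {s : ℕ} (hs : s ∈ S) (hw : ∀ i < N.length, f i ≠ w)
    (hr : Realizes G f N.length w s) (hb : branch next N S O = true) :
    ∃ s T' g, next (CriticalSearch.extend N s) T' = true ∧
      IsNode (CriticalSearch.extend N s) T' G g := by
  induction S with
  | nil => cases hs
  | cons a S ih =>
    have unfold_cons : branch next N (a :: S) O = (next (CriticalSearch.extend N a)
        (double N.length (a :: (S ++ O))) && branch next N S O) := by
      simp only [branch, foldTails_cons, andB_eq, forceList_eq, appB_eq]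
    rw [unfold_cons, Bool.and_eq_true] at hb
    by_cases ha : ∃ x, (∀ i < N.length, f i ≠ x) ∧ Realizes G f N.length x a
    · obtain ⟨x, hx, hxa⟩ := ha
      exact ⟨_, _, _, hb.1, h.extend hx hxa⟩
    · push Not at ha
      have mem_tail {x : V} {l : List ℕ} {t : ℕ} (hx : ∀ i < N.length, f i ≠ x)
          (hr : Realizes G f N.length x t) (ht : t ∈ a :: l) : t ∈ l := by
        rcases List.mem_cons.1 ht with rfl | ht
        exacts [(ha x hx hr).elim, ht]
      refine ih ⟨h.toIsCopy, fun x hx => ?_⟩ (mem_tail hw hr hs) hb.2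
      obtain ⟨t, ht, hxt⟩ := h.exists_type x hx
      exact ⟨t, mem_tail hx hxt ht, hxt⟩

theorem HasType.bit_diff {p : ℕ} {w : V} (hw : HasType N T G f p w) (hf : IsCopy N G f)
    (hLs : ∀ H ∈ Ls, IsGraph H) (hfree : ∀ H ∈ Ls, ∀ g, ¬ IsCopy H G g) {d : ℕ}
    (hd : bit d p = true → ∃ l : List Vtx, l.Sublist (nodeVertices N T) ∧ l.length = 4 ∧
      word (fun u v => bit u.row v.idx) l ++ l.map (fun v => bit v.label p) ∈ words Ls) :
    bit (diff (2 ^ T.length - 1) d) p = true := by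
  have hdp : bit d p = false := by
    by_contra hbit
    obtain ⟨l, hl, hlen, hword⟩ := hd (Bool.eq_true_of_not_eq_false hbit)
    obtain ⟨H, hH, g, hg⟩ := exists_isCopy_of_sublist hLs hf hw.ne
      (fun i hi => hw.bit_column_iff hi) hl hlen hword
    exact hfree H hH g hg
  simp [hdp, hw.lt_length]

theorem not_isNode_of_search (hG : IsVertexCritical (k + 2) G) (hLs : ∀ H ∈ Ls, IsGraph H)
    (hfree : ∀ H ∈ Ls, ∀ g, ¬ IsCopy H G g) {fuel : ℕ} (hN : N ≠ [])
    (hs : search k Ls (words Ls) fuel N T = true) : ¬ IsNode N T G f := by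
  intro h
  induction fuel generalizing N T f with
  | zero => cases hs
  | succ fuel ih =>
    have hs : searchStep k Ls (words Ls) (search k Ls (words Ls) fuel) N T = true := hs
    simp only [searchStep, forceVertices_eq, forceNat_eq, forceList_eq, Nat.sub_eq, Nat.pow_eq,
      sel_eq] at hs
    set alive := diff (2 ^ T.length - 1)
      (deadLast (2 ^ T.length - 1) (words Ls) (nodeVertices N T))
    set m := branchMask k (nodeVertices N T) alive
    split_ifs at hs with hcol
    · have halive (p : ℕ) (w : V) (hw : HasType N T G f p w) : bit alive p = true :=
        hw.bit_diff h.toIsCopy hLs hfree exists_sublist_of_bit_deadLast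
      have hnode : IsNode N (select m T ++ select (diff alive m) T) G f := by
        refine ⟨h.toIsCopy, fun x hx => ?_⟩
        obtain ⟨q, hq⟩ := h.exists_hasType hx
        refine ⟨_, ?_, hq.realizes⟩
        rw [List.mem_append, mem_select, mem_select]
        cases hqm : bit m q with
        | true => exact .inl ⟨q, hq.lt_length, hqm, rfl⟩
        | false => exact .inr ⟨q, hq.lt_length, by simp [halive q x hq, hqm], rfl⟩
      obtain ⟨p, w, hp, hm⟩ := h.hits_branchMask hG hN hcol halive
      obtain ⟨s, T', g, hnext, hg⟩ := hnode.exists_of_branch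
        (mem_select.2 ⟨p, hp.lt_length, hm, rfl⟩) hp.ne hp.realizes hs
      exact ih (by simp [extend]) hnext hg
    · obtain ⟨H, hH, g, hg⟩ :=
        h.exists_isCopy_of_refutes hG hLs (Bool.eq_false_of_not_eq_true hcol) hs
      exact hfree H hH g hg

theorem not_isCopy_of_eliminates (hG : IsVertexCritical (k + 2) G) (hLs : ∀ H ∈ Ls, IsGraph H)
    (hfree : ∀ H ∈ Ls, ∀ g, ¬ IsCopy H G g) {R : List ℕ} (hR : R ≠ [])
    (h : eliminates k Ls R = true) (g : ℕ → V) : ¬ IsCopy R G g := by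
  intro hg
  simp only [eliminates, forceBy_eq forceList_eq, forceVertices_eq, forceNat_eq, forceList_eq,
    Nat.sub_eq, Nat.pow_eq] at h
  refine not_isNode_of_search hG hLs hfree hR h ⟨hg, fun w hw => ?_⟩
  obtain ⟨s, hs, hr⟩ := exists_realizes G g R.length w
  set T := (List.range (2 ^ R.length)).reverse
  obtain ⟨p, hp, rfl⟩ := List.getElem_of_mem (List.mem_reverse.2 (List.mem_range.2 hs) : s ∈ T)
  have hT : T.getD p 0 = T[p] := List.getD_eq_getElem _ _ hp
  have hw : HasType R T G g p w := ⟨hp, hw, hT ▸ hr⟩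
  exact ⟨_, mem_select.2
    ⟨p, hp, hw.bit_diff hg hLs hfree exists_sublist_of_bit_deadAll, hT⟩, hr⟩

theorem not_isCopy_of_eliminatesAll (hG : IsVertexCritical (k + 2) G) {Rs : List (List ℕ)}
    (hLs : ∀ H ∈ Ls, IsGraph H) (hfree : ∀ H ∈ Ls, ∀ g, ¬ IsCopy H G g)
    (hRs : ∀ R ∈ Rs, R ≠ [] ∧ IsGraph R) (h : eliminatesAll k Rs Ls = true) :
    ∀ R ∈ Rs, ∀ g, ¬ IsCopy R G g := by
  induction Rs generalizing Ls with
  | nil => simp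
  | cons R Rs ih =>
    have unfold_cons : eliminatesAll k (R :: Rs) Ls =
        (eliminates k Ls R && eliminatesAll k Rs (R :: Ls)) := by
      rw [← andB_eq]
      rfl
    rw [unfold_cons, Bool.and_eq_true] at h
    rw [List.forall_mem_cons] at hRs
    have hR := not_isCopy_of_eliminates hG hLs hfree hRs.1.1 h.1
    exact List.forall_mem_cons.2 ⟨hR, ih (List.forall_mem_cons.2 ⟨hRs.1.2, hLs⟩)
      (List.forall_mem_cons.2 ⟨hR, hfree⟩) hRs.2 h.2⟩

theorem exists_isCopy_of_eliminatesAll (hG : IsVertexCritical (k + 2) G) {Rs : List (List ℕ)}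
    (hLs : ∀ H ∈ Ls, IsGraph H) (hRs : ∀ R ∈ Rs, R ≠ [] ∧ IsGraph R) (hsingle : [0] ∈ Rs)
    (h : eliminatesAll k Rs Ls = true) : ∃ H ∈ Ls, ∃ g, IsCopy H G g := by
  by_contra! hfree
  obtain ⟨v⟩ := hG.nonempty
  refine not_isCopy_of_eliminatesAll hG hLs hfree hRs h _ hsingle (fun _ => v) ?_
  exact (hRs _ hsingle).2.isCopy fun i hi j hj => absurd hj (by simp_all)

end Search

section Classification

variable {V W : Type*} {G : SimpleGraph V} {H : SimpleGraph W} {N R : List ℕ} {f : ℕ → V}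
  {r : ℕ → W} {k : ℕ} {L : List (List ℕ)}

theorem IsCopy.map (hr : IsCopy R H r) (φ : H ↪g G) : IsCopy R G (φ ∘ r) :=
  ⟨φ.injective.comp_injOn hr.injOn, fun hi j => by simpa using hr.adj_iff hi j⟩

theorem IsFullCopy.map (hr : IsFullCopy R H r) (φ : H ≃g G) : IsFullCopy R G (φ ∘ r) := by
  refine ⟨hr.toIsCopy.map φ.toEmbedding, fun x => ?_⟩
  obtain ⟨i, hi, h⟩ := hr.exists_eq (φ.symm x)
  exact ⟨i, hi, by simp [h]⟩

theorem IsFullCopy.isIndContained_iff (hr : IsFullCopy R H r) :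
    H.IsIndContained G ↔ ∃ g, IsCopy R G g := by
  refine ⟨fun ⟨φ⟩ => ⟨_, hr.toIsCopy.map φ⟩, fun ⟨g, hg⟩ => ?_⟩
  obtain ⟨e, he⟩ := hr.exists_equiv
  refine ⟨⟨⟨fun x => g (e.symm x), fun x y h => ?_⟩, fun {x y} => ?_⟩⟩
  · exact e.symm.injective (Fin.ext (hg.injOn (e.symm x).2 (e.symm y).2 h))
  · have hg' := hg.adj_iff (e.symm x).2 (e.symm y)
    have hr' := hr.adj_iff (e.symm x).2 (e.symm y)
    rw [and_iff_right (e.symm y).2] at hg' hr'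
    rw [← he, ← he, e.apply_symm_apply, e.apply_symm_apply] at hr'
    exact hg'.symm.trans hr'

theorem exists_isFullCopy (hR : IsGraph R) (hne : R ≠ []) (e : Fin R.length ≃ W)
    (h : ∀ i j : Fin R.length, adj R i j = true ↔ H.Adj (e i) (e j)) : ∃ r, IsFullCopy R H r := by
  have : NeZero R.length := ⟨mt List.length_eq_zero_iff.1 hne⟩
  have ofNat_eq {i : ℕ} (hi : i < R.length) : Fin.ofNat R.length i = ⟨i, hi⟩ :=
    Fin.ext (Nat.mod_eq_of_lt hi)
  refine ⟨fun i => e (Fin.ofNat R.length i), hR.isCopy fun i hi j hj => ?_, fun x =>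
    ⟨e.symm x, (e.symm x).2, by rw [ofNat_eq (e.symm x).2, Fin.eta, e.apply_symm_apply]⟩⟩
  rw [ofNat_eq hi, ofNat_eq (hj.trans hi), ← h]
  exact ⟨e.injective.ne (by simpa using hj.ne'), Iff.rfl⟩

/-- The masks of the adjacency lists `L`. -/
def rowsOf (L : List (List ℕ)) : List ℕ :=
  mapB (fun l => fold (fun u m => Nat.lor (Nat.pow 2 u) m) 0 l) L

theorem adj_rowsOf {i : ℕ} (hi : i < L.length) (j : ℕ) : adj (rowsOf L) i j = true ↔ j ∈ L[i] := by
  have bit_fold (l : List ℕ) :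
      bit (fold (fun u m => Nat.lor (Nat.pow 2 u) m) 0 l) j = true ↔ j ∈ l := by
    induction l with
    | nil => simp [fold]
    | cons u l ih =>
      rw [fold_cons, Nat.lor_eq, Nat.pow_eq, bit_or, Bool.or_eq_true, ih, bit_two_pow,
        decide_eq_true_eq, List.mem_cons, eq_comm]
  rw [adj, rowsOf, mapB_eq, List.getD_eq_getElem _ _ (by simpa using hi), List.getElem_map,
    bit_fold]

theorem exists_isFullCopy_adjListGraph (hL : IsGraph (rowsOf L)) (hne : rowsOf L ≠ []) :
    ∃ f, IsFullCopy (rowsOf L) (adjListGraph L) f := by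
  have hlen : (rowsOf L).length = L.length := by simp [rowsOf]
  refine exists_isFullCopy hL hne (finCongr hlen) fun i j => ?_
  have hi := adj_rowsOf (i.2.trans_eq hlen) j
  have hj := adj_rowsOf (j.2.trans_eq hlen) i
  have symm : adj (rowsOf L) j i = true → adj (rowsOf L) i j = true := fun h => (hL j i h).2
  simp only [adjListGraph, SimpleGraph.fromRel_adj, finCongr_apply, Fin.getElem_fin, Fin.val_cast,
    ← hi, ← hj, or_iff_left_of_imp symm]
  exact (and_iff_right_of_imp fun h =>
    (Fin.cast_injective hlen).ne (Fin.ne_of_val_ne (hL i j h).1)).symm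

/-- Whether `N` encodes a `(k + 1)`-vertex-critical graph without induced subgraph in `Fs`. -/
def isCriticalFree (k : ℕ) (Fs : List (List ℕ)) (N : List ℕ) : Bool :=
  forceList N fun N => forceVertices (vertices (fun _ => 0) N) fun vs =>
  andB (graphCheck N) <| andB (not (colourable k vs)) <|
  andB (allB (fun v => colourable k (without v vs)) vs)
    (allB (fun F => not (hasCopy vs (F.map fun s => (s, 0)))) Fs)

theorem isCriticalFree_iff {Fs : List (List ℕ)} : isCriticalFree k Fs N = true ↔
    graphCheck N = true ∧ colourable k (vertices (fun _ => 0) N) = false ∧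
      (∀ v ∈ vertices (fun _ => 0) N, colourable k (without v (vertices (fun _ => 0) N)) = true) ∧
      ∀ F ∈ Fs, hasCopy (vertices (fun _ => 0) N) (F.map fun s => (s, 0)) = false := by
  simp only [isCriticalFree, forceList_eq, forceVertices_eq, andB_eq, allB_eq, Bool.and_eq_true,
    List.all_eq_true, Bool.not_eq_true']

theorem IsFullCopy.isVertexCritical (hf : IsFullCopy N G f) {label : ℕ → ℕ}
    (hcol : colourable k (vertices label N) = false)
    (hwithout : ∀ v ∈ vertices label N, colourable k (without v (vertices label N)) = true) :
    IsVertexCritical (k + 1) G := by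
  refine isVertexCritical_succ_iff.2 ⟨fun hc => ?_, fun x => ?_⟩
  · rw [(colourable_iff fun v hv => hf.represents hv).2
      (hc.of_hom (SimpleGraph.Embedding.induce _).toHom)] at hcol
    cases hcol
  · obtain ⟨i, hi, rfl⟩ := hf.exists_eq x
    have hc := hwithout _ (mem_vertices.2 ⟨i, hi, rfl⟩)
    rw [without, filterB_eq, colourable_iff fun u hu => hf.represents (List.mem_filter.1 hu).1]
      at hc
    refine hc.of_hom (SimpleGraph.induceHomOfLE G fun y hy => ?_).toHom
    obtain ⟨j, hj, rfl⟩ := hf.exists_eq y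
    have hji : j ≠ i := fun h => hy (congrArg f h)
    exact ⟨_, List.mem_filter.2 ⟨mem_vertices.2 ⟨j, hj, rfl⟩,
      by simpa [← Bool.not_eq_true] using hji⟩, rfl⟩

theorem IsFullCopy.hasCopy_of_isCopy (hf : IsFullCopy N G f) {F : List ℕ} {g : ℕ → V}
    (hg : IsCopy F G g) :
    hasCopy (vertices (fun _ => 0) N) (F.map fun s => (s, 0)) = true := by
  choose p hp hfp using fun i => hf.exists_eq (g i)
  refine hasCopy_iff.2 ⟨fun i => ⟨p i, N.getD (p i) 0, 0⟩, fun i hi => ?_⟩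
  rw [List.length_map] at hi
  have getD_map : (F.map fun s => (s, 0)).getD i 0 = (F.getD i 0, 0) := by
    simp [hi]
  refine ⟨mem_vertices.2 ⟨p i, hp i, rfl⟩, by rw [getD_map], fun j hj => ⟨fun h => ?_, ?_⟩⟩
  · exact hj.ne (hg.injOn (hj.trans hi) hi (by rw [← hfp, ← hfp]; exact congrArg f h))
  · have hN := hf.adj_iff (hp i) (p j)
    rw [hfp, hfp, and_iff_right (hp j)] at hN
    have hF := hg.adj_iff hi j
    rw [and_iff_right (hj.trans hi)] at hF
    rw [getD_map, Bool.eq_iff_iff]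
    exact hN.trans hF.symm

theorem isEmpty_iso_of_walkCounts {M : List (List ℕ)} (hL : IsGraph (rowsOf L))
    (hM : IsGraph (rowsOf M)) (hL' : rowsOf L ≠ []) (hM' : rowsOf M ≠ [])
    (hne : ((rowsOf L).length, (walkCounts (rowsOf L) k).sum) ≠
      ((rowsOf M).length, (walkCounts (rowsOf M) k).sum)) :
    IsEmpty (adjListGraph L ≃g adjListGraph M) := by
  refine ⟨fun e => hne ?_⟩
  obtain ⟨f, hf⟩ := exists_isFullCopy_adjListGraph hL hL'
  obtain ⟨g, hg⟩ := exists_isFullCopy_adjListGraph hM hM'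
  obtain ⟨hlen, hsum⟩ := (hf.map e).sum_walkCounts_eq hg k
  rw [hlen, hsum]

theorem pairwise_isEmpty_iso {Ls : List (List (List ℕ))}
    (hLs : ∀ L ∈ Ls, rowsOf L ≠ [] ∧ graphCheck (rowsOf L) = true) (k : ℕ)
    (hne : Ls.Pairwise fun L M => ((rowsOf L).length, (walkCounts (rowsOf L) k).sum) ≠
      ((rowsOf M).length, (walkCounts (rowsOf M) k).sum)) :
    Ls.Pairwise fun L M => IsEmpty (adjListGraph L ≃g adjListGraph M) :=
  hne.imp_of_mem fun hL hM hLM =>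
    isEmpty_iso_of_walkCounts (isGraph_of_graphCheck (hLs _ hL).2)
      (isGraph_of_graphCheck (hLs _ hM).2) (hLs _ hL).1 (hLs _ hM).1 hLM

theorem isVertexCritical_and_isPairFree_iff {W₁ W₂ : Type*} {H₁ : SimpleGraph W₁}
    {H₂ : SimpleGraph W₂} {R₁ R₂ : List ℕ} {r₁ : ℕ → W₁} {r₂ : ℕ → W₂}
    (h₁ : IsFullCopy R₁ H₁ r₁) (h₂ : IsFullCopy R₂ H₂ r₂) (hR₁ : IsGraph R₁) (hR₂ : IsGraph R₂)
    {Ls : List (List (List ℕ))} {Rs : List (List ℕ)}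
    (hLs : ∀ L ∈ Ls, rowsOf L ≠ [] ∧ isCriticalFree (k + 1) [R₁, R₂] (rowsOf L) = true)
    (hRs : ∀ R ∈ Rs, R ≠ [] ∧ IsGraph R) (hsingle : [0] ∈ Rs)
    (helim : eliminatesAll k Rs (R₁ :: R₂ :: Ls.map rowsOf) = true) :
    IsVertexCritical (k + 2) G ∧ IsPairFree H₁ H₂ G ↔
      ∃ L ∈ Ls, Nonempty (G ≃g adjListGraph L) := by
  simp only [isCriticalFree_iff, List.forall_mem_cons] at hLs
  rw [IsPairFree, h₁.isIndContained_iff, h₂.isIndContained_iff]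
  constructor
  · rintro ⟨hG, hG₁, hG₂⟩
    have hgraph : ∀ R ∈ R₁ :: R₂ :: Ls.map rowsOf, IsGraph R := by
      simp only [List.forall_mem_cons, List.forall_mem_map]
      exact ⟨hR₁, hR₂, fun L hL => isGraph_of_graphCheck (hLs L hL).2.1⟩
    obtain ⟨R, hR, g, hg⟩ := exists_isCopy_of_eliminatesAll hG hgraph hRs hsingle helim
    rcases List.mem_cons.1 hR with rfl | hR
    · exact (hG₁ ⟨g, hg⟩).elim
    rcases List.mem_cons.1 hR with rfl | hR
    · exact (hG₂ ⟨g, hg⟩).elim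
    obtain ⟨L, hL, rfl⟩ := List.mem_map.1 hR
    obtain ⟨hne, hgraph, hcol, hwithout, -⟩ := hLs L hL
    obtain ⟨f, hf⟩ := exists_isFullCopy_adjListGraph (isGraph_of_graphCheck hgraph) hne
    obtain ⟨φ⟩ := hf.isIndContained_iff.2 ⟨g, hg⟩
    exact ⟨L, hL, ⟨(RelIso.ofSurjective φ <| hG.surjective_of_embedding
      (hf.isVertexCritical hcol hwithout).not_colorable φ).symm⟩⟩
  · rintro ⟨L, hL, ⟨e⟩⟩
    obtain ⟨hne, hgraph, hcol, hwithout, hfree₁, hfree₂, -⟩ := hLs L hL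
    obtain ⟨f, hf⟩ := exists_isFullCopy_adjListGraph (isGraph_of_graphCheck hgraph) hne
    have hf := hf.map e.symm
    refine ⟨hf.isVertexCritical hcol hwithout, fun ⟨g, hg⟩ => ?_, fun ⟨g, hg⟩ => ?_⟩
    · exact absurd (hf.hasCopy_of_isCopy hg) (by simp [hfree₁])
    · exact absurd (hf.hasCopy_of_isCopy hg) (by simp [hfree₂])

end Classification

section Lists

/-- The path `P₅`. -/
def pathRows : List ℕ :=
  [2, 5, 10, 20, 8]

/-- The gem, numbered as in `gem`. -/
def gemRows : List ℕ :=
  [18, 21, 26, 20, 15]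

/-- The complement of `P₃ + P₂`, where `0`, `1`, `2` form the `P₃`. -/
def coP3P2Rows : List ℕ :=
  [28, 24, 25, 7, 7]

theorem exists_isFullCopy_pathGraph : ∃ r, IsFullCopy pathRows (SimpleGraph.pathGraph 5) r :=
  exists_isFullCopy (isGraph_of_graphCheck (by decide)) (by decide) (Equiv.refl (Fin 5)) <| by
    simp only [SimpleGraph.pathGraph_adj]
    decide

theorem exists_isFullCopy_gem : ∃ r, IsFullCopy gemRows gem r :=
  exists_isFullCopy (isGraph_of_graphCheck (by decide)) (by decide) (Equiv.refl (Fin 5)) <| by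
    simp only [gem, SimpleGraph.fromRel_adj]
    decide

theorem exists_isFullCopy_coP3P2 : ∃ r, IsFullCopy coP3P2Rows coP3P2 r := by
  have h : ∀ x y : Fin 3 ⊕ Fin 2,
      adj coP3P2Rows (finSumFinEquiv x) (finSumFinEquiv y) = true ↔ coP3P2.Adj x y := by
    simp only [coP3P2, SimpleGraph.compl_adj, Sum.forall, SimpleGraph.sum_adj,
      SimpleGraph.pathGraph_adj]
    decide
  let e : Fin coP3P2Rows.length ≃ Fin 3 ⊕ Fin 2 := (finSumFinEquiv (m := 3) (n := 2)).symm
  exact exists_isFullCopy (isGraph_of_graphCheck (by decide)) (by decide) e fun i j => by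
    have hval (x : Fin coP3P2Rows.length) : (finSumFinEquiv (e x)).val = x.val :=
      congrArg Fin.val ((finSumFinEquiv (m := 3) (n := 2)).apply_symm_apply x)
    simpa only [hval] using h (e i) (e j)

/-- The bull, the chair, the kite and the single vertex. -/
def gemSteps : List (List ℕ) :=
  [[24, 8, 16, 19, 13], [24, 16, 16, 1, 7], [28, 24, 1, 19, 11], [0]]

/-- The house, the kite, the gem and the single vertex. -/
def coP3P2Steps : List (List ℕ) :=
  [[28, 24, 17, 3, 7], [28, 24, 1, 19, 11], gemRows, [0]]

set_option maxRecDepth 100000 in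
set_option maxHeartbeats 0 in
-- the kernel runs the whole search
theorem eliminatesAll_gemSteps :
    eliminatesAll 3 gemSteps (pathRows :: gemRows :: gemList.map rowsOf) = true := by
  decide +kernel

set_option maxRecDepth 100000 in
set_option maxHeartbeats 0 in
-- the kernel runs the whole search
theorem eliminatesAll_coP3P2Steps :
    eliminatesAll 3 coP3P2Steps (pathRows :: coP3P2Rows :: coP3P2List.map rowsOf) = true := by
  decide +kernel

theorem critical_gem_iff {V : Type*} (G : SimpleGraph V) :
    IsVertexCritical 5 G ∧ IsPairFree (SimpleGraph.pathGraph 5) gem G ↔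
      ∃ L ∈ gemList, Nonempty (G ≃g adjListGraph L) := by
  obtain ⟨_, hpath⟩ := exists_isFullCopy_pathGraph
  obtain ⟨_, hgem⟩ := exists_isFullCopy_gem
  have hRs : ∀ R ∈ gemSteps, R ≠ [] ∧ graphCheck R = true := by decide
  exact isVertexCritical_and_isPairFree_iff hpath hgem (isGraph_of_graphCheck (by decide))
    (isGraph_of_graphCheck (by decide)) (by decide +kernel)
    (fun R hR => ⟨(hRs R hR).1, isGraph_of_graphCheck (hRs R hR).2⟩) (by decide)
    eliminatesAll_gemSteps

theorem critical_coP3P2_iff {V : Type*} (G : SimpleGraph V) :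
    IsVertexCritical 5 G ∧ IsPairFree (SimpleGraph.pathGraph 5) coP3P2 G ↔
      ∃ L ∈ coP3P2List, Nonempty (G ≃g adjListGraph L) := by
  obtain ⟨_, hpath⟩ := exists_isFullCopy_pathGraph
  obtain ⟨_, hco⟩ := exists_isFullCopy_coP3P2
  have hRs : ∀ R ∈ coP3P2Steps, R ≠ [] ∧ graphCheck R = true := by decide
  exact isVertexCritical_and_isPairFree_iff hpath hco (isGraph_of_graphCheck (by decide))
    (isGraph_of_graphCheck (by decide)) (by decide +kernel)
    (fun R hR => ⟨(hRs R hR).1, isGraph_of_graphCheck (hRs R hR).2⟩) (by decide)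
    eliminatesAll_coP3P2Steps

theorem pairwise_isEmpty_iso_gemList :
    gemList.Pairwise fun L M => IsEmpty (adjListGraph L ≃g adjListGraph M) :=
  pairwise_isEmpty_iso (by decide +kernel) 4 (by decide +kernel)

theorem pairwise_isEmpty_iso_coP3P2List :
    coP3P2List.Pairwise fun L M => IsEmpty (adjListGraph L ≃g adjListGraph M) :=
  pairwise_isEmpty_iso (by decide +kernel) 4 (by decide +kernel)

end Lists

end CriticalSearch

open CriticalSearch in
theorem theorem3p4_general :
    ((criticalClasses 5 (SimpleGraph.pathGraph 5) gem).encard = 7 ∧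
      (∀ (V : Type*) (G : SimpleGraph V),
        (IsVertexCritical 5 G ∧ IsPairFree (SimpleGraph.pathGraph 5) gem G) ↔
          ∃ L ∈ gemList, Nonempty (G ≃g adjListGraph L)) ∧
      gemList.Pairwise fun L M => IsEmpty (adjListGraph L ≃g adjListGraph M)) ∧
    ((criticalClasses 5 (SimpleGraph.pathGraph 5) coP3P2).encard = 20 ∧
      (∀ (V : Type*) (G : SimpleGraph V),
        (IsVertexCritical 5 G ∧ IsPairFree (SimpleGraph.pathGraph 5) coP3P2 G) ↔
          ∃ L ∈ coP3P2List, Nonempty (G ≃g adjListGraph L)) ∧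
      coP3P2List.Pairwise fun L M => IsEmpty (adjListGraph L ≃g adjListGraph M)) :=
  ⟨⟨encard_criticalClasses (fun _ => critical_gem_iff) pairwise_isEmpty_iso_gemList,
      fun _ => critical_gem_iff, pairwise_isEmpty_iso_gemList⟩,
    encard_criticalClasses (fun _ => critical_coP3P2_iff) pairwise_isEmpty_iso_coP3P2List,
    fun _ => critical_coP3P2_iff, pairwise_isEmpty_iso_coP3P2List⟩

theorem theorem3p4 :
    ((criticalClasses 5 (SimpleGraph.pathGraph 5) gem).encard = 7 ∧
      (∀ (V : Type*) [Finite V] (G : SimpleGraph V),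
        (IsVertexCritical 5 G ∧ IsPairFree (SimpleGraph.pathGraph 5) gem G) ↔
          ∃ L ∈ gemList, Nonempty (G ≃g adjListGraph L)) ∧
      gemList.Pairwise fun L M => IsEmpty (adjListGraph L ≃g adjListGraph M)) ∧
    ((criticalClasses 5 (SimpleGraph.pathGraph 5) coP3P2).encard = 20 ∧
      (∀ (V : Type*) [Finite V] (G : SimpleGraph V),
        (IsVertexCritical 5 G ∧ IsPairFree (SimpleGraph.pathGraph 5) coP3P2 G) ↔
          ∃ L ∈ coP3P2List, Nonempty (G ≃g adjListGraph L)) ∧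
      coP3P2List.Pairwise fun L M => IsEmpty (adjListGraph L ≃g adjListGraph M)) := by
  obtain ⟨⟨h₁, h₂, h₃⟩, h₄, h₅, h₆⟩ := theorem3p4_general
  exact ⟨⟨h₁, fun V _ G => h₂ V G, h₃⟩, h₄, fun V _ G => h₅ V G, h₆⟩
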